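/- **Theorem (Sparse ARSM for multidimensional discrete action space).** Consider a Markov decision process with measurable state space $\mathcal S$, initial law $\mathcal P(s_0)$, transition kernel $\mathcal P(\cdot\mid s,\mathbf a)$, actions $\mathbf a=(a_1,\dots,a_K)\in\{1,\dots,C\}^K$, measurable reward $r(s,\mathbf a)$ and discount factor $\gamma\in(0,1]$. At time $t=0,1,2,\dots$ the policy has state-dependent logits $\phi_{tkc}=\phi_{tkc}(s_t)$ (measurable in the state) and independent coordinates, $P(\mathbf a_t\mid s_t)=\prod_{k=1}^K\mathrm{Categorical}(a_{tk};\sigma(\phi_{tk}))$ with $\sigma$ the softmax function. Let $$J(\phi_{0:\infty})=\mathbb E\Big[\sum_{n\ge0}\gamma^{n}r(s_n,\mathbf a_n)\Big],\qquad Q(s_t,\mathbf a_t)=\mathbb E\Big[\sum_{n\ge t}\gamma^{n-t}r(s_n,\mathbf a_n)\,\Big|\,s_t,\mathbf a_t\Big],$$ and assume that $J$ is well defined at $\phi_{0:\infty}$, i.e. $\mathbb E\big[\sum_{n\ge0}\gamma^{n}|r(s_n,\mathbf a_n)|\big]<\infty$. For $\varpi_t=(\varpi_{t1},\dots,\varpi_{tK})$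 with independent $\varpi_{tk}\sim\mathrm{Dir}(\mathbf 1_C)$, let $\varpi_{tk}^{c\rightleftharpoons j}$ be $\varpi_{tk}$ with its entries $c$ and $j$ swapped and put $$a_{tk}=\operatorname*{arg\,min}_{i}\varpi_{tki}e^{-\phi_{tki}},\qquad a_{tk}^{c\rightleftharpoons j}=\operatorname*{arg\,min}_{i}\varpi_{tki}^{c\rightleftharpoons j}e^{-\phi_{tki}},\qquad \mathbf a_t^{c\rightleftharpoons j}=(a_{t1}^{c\rightleftharpoons j},\dots,a_{tK}^{c\rightleftharpoons j}),$$ $$\Delta_{c,j}=Q(s_t,\mathbf a_t^{c\rightleftharpoons j})-\frac1C\sum_{m=1}^C Q(s_t,\mathbf a_t^{m\rightleftharpoons j}),\qquad g_{tkc}=\begin{cases}0,&\text{if } a_{tk}^{m\rightleftharpoons j}=a_{tk}\text{ for all }m,j,\\ \sum_{j=1}^C\Delta_{c,j}\big(\tfrac1C-\varpi_{tkj}\big),&\text{otherwise.}\end{cases}$$ Then for all $t,k,c$ the partial derivative of $J$ with respect to $\phi_{tkc}$ exists and $$\nabla_{\phi_{tkc}}J(\phi_{0:\infty})=\mathbb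 E_{s_t}\Big\{\gamma^t\,\mathbb E_{\varpi_t\sim\prod_{k=1}^K\mathrm{Dir}(\mathbf 1_C)}[g_{tkc}]\Big\},$$ where $s_t$ has its marginal law under the policy. Here $\nabla_{\phi_{tkc}}J$ is the derivative at $x=0$ when $\phi_{tkc}(\cdot)$ is replaced by $\phi_{tkc}(\cdot)+x$ and all other logits are kept; more generally, for every bounded measurable $h:\mathcal S\to\mathbb R$, replacing $\phi_{tkc}(\cdot)$ by $\phi_{tkc}(\cdot)+x\,h(\cdot)$ gives the derivative $\mathbb E_{s_t}\{h(s_t)\,\gamma^t\,\mathbb E_{\varpi_t}[g_{tkc}]\}$. All these expectations are well defined: the perturbed discounted returns are absolutely integrable, $Q(s_t,\mathbf a)$ is defined for almost every $s_t$ and every $\mathbf a$, and $g_{tkc}$ is jointly integrable. The same formulas hold without the case distinction, i.e. with $g_{tkc}=\sum_{j}\Delta_{c,j}(\tfrac1C-\varpi_{tkj})$ throughout; so $g_{tkc}$ may be set to $0$ whenever every pseudo action $a_{tk}^{m\rightleftharpoons j}$ equals the true action $a_{tk}$. -/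

import Mathlib

open MeasureTheory ProbabilityTheory
open scoped ENNReal

namespace ARSM

noncomputable section

/-- Joint actions: `K` dimensions, each with `C` categories. -/
abbrev Action (K C : ℕ) : Type := Fin K → Fin C

/-- The softmax function `σ`. -/
def softmax {C : ℕ} (x : Fin C → ℝ) (i : Fin C) : ℝ :=
  Real.exp (x i) / ∑ j, Real.exp (x j)

lemma softmax_nonneg {C : ℕ} (x : Fin C → ℝ) (i : Fin C) : 0 ≤ softmax x i :=
  div_nonneg (Real.exp_pos _).le (Finset.sum_nonneg fun _ _ => (Real.exp_pos _).le)

lemma sum_softmax {C : ℕ} [NeZero C] (x : Fin C → ℝ) : ∑ i, softmax x i = 1 := by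
  have h : 0 < ∑ j, Real.exp (x j) :=
    Finset.sum_pos (fun _ _ => Real.exp_pos _) Finset.univ_nonempty
  simp only [softmax, ← Finset.sum_div]
  exact div_self h.ne'

lemma measurable_softmax {C : ℕ} (i : Fin C) : Measurable fun x : Fin C → ℝ => softmax x i := by
  unfold softmax
  fun_prop

/-- The law of a joint action with independent softmax-categorical coordinates:
`P(a | x) = ∏ k, Categorical(a k; σ(x k))`. -/
def actionPMF {K C : ℕ} [NeZero C] (x : Fin K → Fin C → ℝ) : PMF (Action K C) :=
  PMF.ofFintype (fun a => ENNReal.ofReal (∏ k, softmax (x k) (a k))) (by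
    rw [← ENNReal.ofReal_sum_of_nonneg
      fun a _ => Finset.prod_nonneg fun k _ => softmax_nonneg _ _]
    have h := Finset.prod_univ_sum (fun _ : Fin K => (Finset.univ : Finset (Fin C)))
      (fun k i => softmax (x k) i)
    rw [Fintype.piFinset_univ] at h
    rw [← h]
    simp [sum_softmax])

lemma measurable_actionPMF {K C : ℕ} [NeZero C] :
    Measurable fun x : Fin K → Fin C → ℝ => (actionPMF x).toMeasure := by
  refine Measure.measurable_of_measurable_coe _ fun B hB => ?_
  simp only [PMF.toMeasure_apply_fintype]
  refine Finset.measurable_sum _ fun a _ => ?_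
  by_cases ha : a ∈ B
  · simp only [Set.indicator_of_mem ha, actionPMF, PMF.ofFintype_apply]
    refine ENNReal.measurable_ofReal.comp (Finset.measurable_prod _ fun k _ => ?_)
    exact (measurable_softmax (a k)).comp (measurable_pi_apply k)
  · simp [Set.indicator_of_notMem ha]

/-- A sequence `φ_0, φ_1, …` of (measurable) state-dependent logits; `φ.val t s k c` is the
logit `φ_{tkc}` in state `s`. -/
structure LogitSeq (S : Type*) [MeasurableSpace S] (K C : ℕ) where
  val : ℕ → S → Fin K → Fin C → ℝ
  measurable_val : ∀ t, Measurable (val t)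

section MDP

variable {S : Type*} [MeasurableSpace S] {K C : ℕ}

/-- The logits from time `t` on. -/
def LogitSeq.tail (φ : LogitSeq S K C) (t : ℕ) : LogitSeq S K C where
  val n := φ.val (t + n)
  measurable_val n := φ.measurable_val (t + n)

/-- The logit `φ_{tkc}` is replaced by `φ_{tkc} + x * h`; all other logits are unchanged. -/
def LogitSeq.perturb (φ : LogitSeq S K C) (t : ℕ) (k : Fin K) (c : Fin C)
    (h : S → ℝ) (hh : Measurable h) (x : ℝ) : LogitSeq S K C where
  val n s k' c' := φ.val n s k' c' + if n = t ∧ k' = k ∧ c' = c then x * h s else 0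
  measurable_val n := by
    refine measurable_pi_lambda _ fun k' => measurable_pi_lambda _ fun c' => ?_
    have h1 : Measurable fun s => φ.val n s k' c' :=
      (measurable_pi_apply c').comp ((measurable_pi_apply k').comp (φ.measurable_val n))
    refine h1.add ?_
    split_ifs
    · exact hh.const_mul x
    · exact measurable_const

variable [NeZero C]

/-- The policy at time `t`: in state `s` the action has independent coordinates
`a k ∼ Categorical(σ(φ_{tk}(s)))`. -/
def policy (φ : LogitSeq S K C) (t : ℕ) : Kernel S (Action K C) where
  toFun s := (actionPMF (φ.val t s)).toMeasure
  measurable' := measurable_actionPMF.comp (φ.measurable_val t)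

instance (φ : LogitSeq S K C) (t : ℕ) : IsMarkovKernel (policy φ t) :=
  ⟨fun s => by change IsProbabilityMeasure (actionPMF (φ.val t s)).toMeasure; infer_instance⟩

/-- One step of the controlled chain: from `(s_n, a_n)` draw `s_{n+1} ∼ P(· | s_n, a_n)` and then
`a_{n+1}` from the policy at time `n + 1` in state `s_{n+1}`. -/
def step (P : Kernel (S × Action K C) S) (φ : LogitSeq S K C) (n : ℕ) :
    Kernel (S × Action K C) (S × Action K C) :=
  P ⊗ₖ Kernel.prodMkLeft (S × Action K C) (policy φ (n + 1))

instance (P : Kernel (S × Action K C) S) [IsMarkovKernel P] (φ : LogitSeq S K C) (n : ℕ) :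
    IsMarkovKernel (step P φ n) := by
  unfold step; infer_instance

/-- `step`, as a kernel on the history up to time `n`. -/
def historyStep (P : Kernel (S × Action K C) S) (φ : LogitSeq S K C) (n : ℕ) :
    Kernel (Π _ : Finset.Iic n, S × Action K C) (S × Action K C) :=
  (step P φ n).comap (fun w => w ⟨n, Finset.mem_Iic.2 le_rfl⟩) (measurable_pi_apply _)

instance (P : Kernel (S × Action K C) S) [IsMarkovKernel P] (φ : LogitSeq S K C) (n : ℕ) :
    IsMarkovKernel (historyStep P φ n) := by
  unfold historyStep; infer_instance

/-- The law of the trajectory `(s_0, a_0), (s_1, a_1), …` when `(s_0, a_0) ∼ ν` and the policies at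
times `1, 2, …` have logits `φ_1, φ_2, …`. -/
def rollout (P : Kernel (S × Action K C) S) [IsMarkovKernel P] (φ : LogitSeq S K C)
    (ν : Measure (S × Action K C)) : Measure (ℕ → S × Action K C) :=
  Kernel.trajMeasure (X := fun _ => S × Action K C) ν (historyStep P φ)

/-- The law of the trajectory started from `s_0 ∼ μ₀` under the policy with logits `φ`. -/
def trajLaw (P : Kernel (S × Action K C) S) [IsMarkovKernel P] (μ₀ : Measure S)
    (φ : LogitSeq S K C) : Measure (ℕ → S × Action K C) :=
  rollout P φ (μ₀ ⊗ₘ policy φ 0)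

/-- The law of the trajectory `(s_t, a_t), (s_{t+1}, a_{t+1}), …` given `s_t = s`, `a_t = a`. -/
def trajLawFrom (P : Kernel (S × Action K C) S) [IsMarkovKernel P] (φ : LogitSeq S K C)
    (t : ℕ) (s : S) (a : Action K C) : Measure (ℕ → S × Action K C) :=
  rollout P (φ.tail t) (Measure.dirac (s, a))

/-- The marginal law of the state `s_t`. -/
def stateLaw (P : Kernel (S × Action K C) S) [IsMarkovKernel P] (μ₀ : Measure S)
    (φ : LogitSeq S K C) (t : ℕ) : Measure S :=
  (trajLaw P μ₀ φ).map fun w => (w t).1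

/-- The discounted return `∑ γ^n r(s_n, a_n)` is absolutely integrable under `m`. -/
def ReturnIntegrable (γ : ℝ) (r : S × Action K C → ℝ) (m : Measure (ℕ → S × Action K C)) : Prop :=
  ∫⁻ w, ∑' n, ENNReal.ofReal (γ ^ n * |r (w n)|) ∂m < ∞

/-- The expected discounted return `J(φ_{0:∞})`. -/
def J (P : Kernel (S × Action K C) S) [IsMarkovKernel P] (μ₀ : Measure S)
    (γ : ℝ) (r : S × Action K C → ℝ) (φ : LogitSeq S K C) : ℝ :=
  ∫ w, ∑' n, γ ^ n * r (w n) ∂(trajLaw P μ₀ φ)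

/-- The action-value function at time `t`:
the expectation of `∑_{t' ≥ t} γ^(t' - t) r(s_{t'}, a_{t'})` given `s_t = s`, `a_t = a`. -/
def Q (P : Kernel (S × Action K C) S) [IsMarkovKernel P]
    (γ : ℝ) (r : S × Action K C → ℝ) (φ : LogitSeq S K C) (t : ℕ) (s : S) (a : Action K C) : ℝ :=
  ∫ w, ∑' n, γ ^ n * r (w n) ∂(trajLawFrom P φ t s a)

end MDP

/-- The Dirichlet distribution with parameters `α i > 0`: the law of a vector of independent
`Gamma(α i, 1)` variables divided by its sum. -/
def dirichlet {C : ℕ} (α : Fin C → ℝ) : Measure (Fin C → ℝ) :=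
  (Measure.pi fun i => gammaMeasure (α i) 1).map fun y i => y i / ∑ j, y j

/-- The joint law of `K` independent `Dir(1_C)` vectors. -/
def dirichletProd (K C : ℕ) : Measure (Fin K → Fin C → ℝ) :=
  Measure.pi fun _ => dirichlet fun _ : Fin C => (1 : ℝ)

section Gradient

variable {K C : ℕ} [NeZero C]

/-- The index of the smallest entry (the first such index, if there are several). -/
def argmin (f : Fin C → ℝ) : Fin C :=
  (Finset.univ.filter fun i => ∀ j, f i ≤ f j).min' (by
    obtain ⟨i, hi⟩ := Finite.exists_min f
    exact ⟨i, by simpa using hi⟩)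

/-- The true action `a_k = argmin_i ϖ_{ki} exp(-x_{ki})`. -/
def trueAction (x ϖ : Fin K → Fin C → ℝ) : Action K C :=
  fun k => argmin fun i => ϖ k i * Real.exp (-x k i)

/-- The pseudo action `a^{c ⇌ j}`: in every dimension, the entries `c` and `j` of `ϖ_k` are
swapped. -/
def pseudoAction (x ϖ : Fin K → Fin C → ℝ) (c j : Fin C) : Action K C :=
  trueAction x fun k i => ϖ k (Equiv.swap c j i)

/-- `Δ_{c,j} = q(a^{c ⇌ j}) - (1/C) ∑_m q(a^{m ⇌ j})`. -/
def swapDiff (q : Action K C → ℝ) (x ϖ : Fin K → Fin C → ℝ) (c j : Fin C) : ℝ :=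
  q (pseudoAction x ϖ c j) - 1 / (C : ℝ) * ∑ m, q (pseudoAction x ϖ m j)

/-- The ARSM quantity `∑_j Δ_{c,j} (1/C - ϖ_{kj})`, without sparsification. -/
def denseG (q : Action K C → ℝ) (x ϖ : Fin K → Fin C → ℝ) (k : Fin K) (c : Fin C) : ℝ :=
  ∑ j, swapDiff q x ϖ c j * (1 / (C : ℝ) - ϖ k j)

/-- The sparse ARSM quantity `g_{kc}`: dimension `k` is shut off when all of its pseudo actions
equal its true action. -/
def sparseG (q : Action K C → ℝ) (x ϖ : Fin K → Fin C → ℝ) (k : Fin K) (c : Fin C) : ℝ :=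
  if ∀ m j : Fin C, pseudoAction x ϖ m j k = trueAction x ϖ k then 0 else denseG q x ϖ k c

end Gradient

end

end ARSM

namespace ARSM

noncomputable section

/-! Both sides equal the expectation, under the law of `s_t`, of `h(s_t) γ^t` times `policyGrad`,
the exact partial derivative in the logit `(k, c)` of `∑ a, Q(s,a) P(a | s)`.

Dirichlet side. A `Dir(1_C)` vector is a normalized vector of independent standard exponentials, so
the argmin is the winner of an exponential race and has the softmax law (`dirichlet_setOf_argmin`).
Writing `1/∑ y` as `∫ exp(-u ∑ y) du` over `u > 0` decouples the coordinates again and gives the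
mean of `1/C - ϖ_c` on the event that `a` wins, namely `σ_a (1{a=c} - σ_c) / C`
(`integral_dirichlet_argmin`). This is the softmax derivative divided by `C`; independence of the
dimensions lifts it to joint actions (`integral_trueAction_mul`). Swapping entries `c` and `j` in
every dimension preserves the law and turns the pseudo action paired with `ϖ_{kj}` into the true
action paired with `ϖ_{kc}`. Hence each of the `C` values of `j` contributes `policyGrad / C`, while
the baseline contributes zero because the partial derivatives sum to zero over `c`
(`integral_denseG`). For the sparse version, consider the event that all pseudo actions agree with
the true one in dimension `k`. Swapping only in the other dimensions preserves this event, the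
vector `ϖ_k` and the law, so every pseudo action can be replaced by the true action under the
integral, and the centred differences integrate to zero (`setIntegral_agreeSet_denseG`).

Markov decision side. The expected return is the integral of `r` against a discounted occupation
measure. Perturbing the policy at time `t` alone changes neither the part before `t`, nor the law of
`s_t`, nor the continuation after `(s_t, a_t)` (`occupation_comp_eq_of_policy_eq`). Only a finite
sum over actions inside an integral over `s_t` depends on the perturbation. A bounded perturbation
changes action probabilities by a bounded factor, so integrability at `φ` passes to all
perturbations and justifies differentiation under the integral (`hasDerivAt_integral_perturb`). -/

/-! ### Explicit integrals over half-lines. -/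

lemma lintegral_Ioi_of_hasDerivAt {g g' : ℝ → ℝ} {a l : ℝ}
    (hd : ∀ x ∈ Set.Ici a, HasDerivAt g (g' x) x) (h0 : ∀ x ∈ Set.Ioi a, 0 ≤ g' x)
    (hl : Filter.Tendsto g Filter.atTop (nhds l)) :
    ∫⁻ x in Set.Ioi a, ENNReal.ofReal (g' x) = ENNReal.ofReal (l - g a) := by
  rw [← integral_Ioi_of_hasDerivAt_of_nonneg' hd h0 hl, ofReal_integral_eq_lintegral_ofReal]
  · exact integrableOn_Ioi_deriv_of_nonneg' hd h0 hl
  · exact (ae_restrict_iff' measurableSet_Ioi).2 (Filter.Eventually.of_forall h0)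

lemma tendsto_mul_exp_neg_mul {v : ℝ} (hv : 0 < v) :
    Filter.Tendsto (fun x : ℝ => x * Real.exp (-(v * x))) Filter.atTop (nhds 0) := by
  have h := (Real.tendsto_pow_mul_exp_neg_atTop_nhds_zero 1).comp
    (Filter.tendsto_id.const_mul_atTop hv)
  have h' := h.const_mul v⁻¹
  rw [mul_zero] at h'
  refine h'.congr fun x => ?_
  simp only [Function.comp, id, pow_one]
  field_simp

lemma tendsto_exp_neg_mul {v : ℝ} (hv : 0 < v) :
    Filter.Tendsto (fun x : ℝ => Real.exp (-(v * x))) Filter.atTop (nhds 0) :=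
  Real.tendsto_exp_neg_atTop_nhds_zero.comp (Filter.tendsto_id.const_mul_atTop hv)

lemma lintegral_Ioi_exp_neg_mul (t : ℝ) {v : ℝ} (hv : 0 < v) :
    ∫⁻ y in Set.Ioi t, ENNReal.ofReal (Real.exp (-(v * y))) =
      ENNReal.ofReal (Real.exp (-(v * t)) / v) := by
  have h := lintegral_Ioi_of_hasDerivAt (a := t) (l := 0)
    (g := fun y => -(Real.exp (-(v * y)) / v)) (g' := fun y => Real.exp (-(v * y)))
    (fun x _ => ?_) (fun x _ => (Real.exp_pos _).le) ?_
  · simpa using h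
  · have := ((((hasDerivAt_id x).const_mul v).neg).exp.div_const v).neg
    convert! this using 1
    simp; field_simp
  · simpa using ((tendsto_exp_neg_mul hv).div_const v).neg

lemma lintegral_Ioi_add_mul_exp_neg_mul {t α β : ℝ} (ht : 0 ≤ t) (hα : 0 ≤ α) (hβ : 0 ≤ β)
    {v : ℝ} (hv : 0 < v) :
    ∫⁻ y in Set.Ioi t, ENNReal.ofReal ((α * y + β) * Real.exp (-(v * y))) =
      ENNReal.ofReal ((α * t + α / v + β) * Real.exp (-(v * t)) / v) := by
  have h := lintegral_Ioi_of_hasDerivAt (a := t) (l := 0)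
    (g := fun y => -((α * y + (α / v + β)) * Real.exp (-(v * y)) / v))
    (g' := fun y => (α * y + β) * Real.exp (-(v * y)))
    (fun x _ => ?_) (fun x hx => ?_) ?_
  · rw [h]; congr 1; ring
  · have := (((((hasDerivAt_id x).const_mul α).add_const (α / v + β)).mul
      ((hasDerivAt_id x).const_mul v).neg.exp).div_const v).neg
    convert! this using 1
    simp; field_simp; ring
  · have : 0 ≤ x := ht.trans (Set.mem_Ioi.1 hx).le
    positivity
  · have h1 := ((((tendsto_mul_exp_neg_mul hv).const_mul α).add
      ((tendsto_exp_neg_mul hv).const_mul (α / v + β))).div_const v).neg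
    simp only [mul_zero, add_zero, zero_div, neg_zero] at h1
    refine h1.congr fun x => ?_
    ring

lemma lintegral_Ioi_one_add_zpow (n : ℕ) :
    ∫⁻ u in Set.Ioi (0 : ℝ), ENNReal.ofReal (((1 + u) ^ (n + 2))⁻¹) =
      ENNReal.ofReal (1 / ((n + 1 : ℕ) : ℝ)) := by
  have h := lintegral_Ioi_of_hasDerivAt (a := 0) (l := 0)
    (g := fun u : ℝ => -(((1 + u) ^ (n + 1))⁻¹ / ((n + 1 : ℕ) : ℝ)))
    (g' := fun u => ((1 + u) ^ (n + 2))⁻¹)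
    (fun x hx => ?_) (fun x hx => ?_) ?_
  · rw [h]; simp
  · have hx : 0 ≤ x := hx
    have := (((((hasDerivAt_id x).const_add 1).pow (n + 1)).inv
      (by simp; positivity)).div_const ((n + 1 : ℕ) : ℝ)).neg
    convert! this using 1
    simp; field_simp; ring
  · have hx : 0 < x := hx
    positivity
  · have h1 : Filter.Tendsto (fun u : ℝ => (1 + u) ^ (n + 1)) Filter.atTop Filter.atTop :=
      (Filter.tendsto_pow_atTop n.succ_ne_zero).comp
        (Filter.tendsto_atTop_add_const_left _ _ Filter.tendsto_id)
    simpa using (h1.inv_tendsto_atTop.div_const ((n + 1 : ℕ) : ℝ)).neg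

/-! ### The standard exponential law as `gammaMeasure 1 1`. -/

instance : IsProbabilityMeasure (gammaMeasure 1 1) :=
  isProbabilityMeasure_gammaMeasure one_pos one_pos

lemma gammaMeasure_one_one :
    gammaMeasure 1 1 = (volume.restrict (Set.Ioi 0)).withDensity
      fun y => ENNReal.ofReal (Real.exp (-y)) := by
  rw [Measure.restrict_congr_set Ioi_ae_eq_Ici, ← withDensity_indicator measurableSet_Ici, gammaMeasure]
  congr 1
  ext y
  by_cases hy : 0 ≤ y
  · simp [Set.indicator, hy, gammaPDF_of_nonneg]
  · simp [Set.indicator, hy, gammaPDF_of_neg (not_le.1 hy)]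

lemma lintegral_gammaMeasure_one_one {f : ℝ → ℝ≥0∞} (hf : Measurable f) :
    ∫⁻ y, f y ∂gammaMeasure 1 1 =
      ∫⁻ y in Set.Ioi 0, ENNReal.ofReal (Real.exp (-y)) * f y := by
  rw [gammaMeasure_one_one, lintegral_withDensity_eq_lintegral_mul _ (by fun_prop) hf]
  rfl

lemma setLIntegral_Ioi_gammaMeasure_one_one {f : ℝ → ℝ≥0∞} (hf : Measurable f) {t : ℝ}
    (ht : 0 ≤ t) :
    ∫⁻ y in Set.Ioi t, f y ∂gammaMeasure 1 1 =
      ∫⁻ y in Set.Ioi t, ENNReal.ofReal (Real.exp (-y)) * f y := by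
  rw [← lintegral_indicator measurableSet_Ioi,
    lintegral_gammaMeasure_one_one (hf.indicator measurableSet_Ioi),
    ← lintegral_indicator measurableSet_Ioi, ← lintegral_indicator measurableSet_Ioi]
  congr 1
  ext y
  by_cases hy : t < y
  · simp [Set.indicator, hy, ht.trans_lt hy]
  · simp [Set.indicator, hy]

lemma ae_pos_gammaMeasure_one_one : ∀ᵐ y ∂gammaMeasure 1 1, 0 < y := by
  rw [gammaMeasure_one_one]
  exact (withDensity_absolutelyContinuous _ _).ae_le (ae_restrict_mem measurableSet_Ioi)

lemma ae_pos_pi_gammaMeasure (C : ℕ) :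
    ∀ᵐ y : Fin C → ℝ ∂(Measure.pi fun _ => gammaMeasure 1 1), ∀ i, 0 < y i :=
  ae_all_iff.2 fun i =>
    (measurePreserving_eval (fun _ => gammaMeasure 1 1) i).quasiMeasurePreserving.ae
      ae_pos_gammaMeasure_one_one

/-! ### The exponential race. -/

/-- The event that coordinate `a` is the strict minimum of `y i * d i`. -/
def strictMinSet {C : ℕ} (d : Fin C → ℝ) (a : Fin C) : Set (Fin C → ℝ) :=
  {y | ∀ i, i ≠ a → y a * d a < y i * d i}

lemma measurableSet_strictMinSet {C : ℕ} (d : Fin C → ℝ) (a : Fin C) :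
    MeasurableSet (strictMinSet d a) := by
  have : strictMinSet d a = ⋂ i, {y | i ≠ a → y a * d a < y i * d i} := by
    ext; simp [strictMinSet]
  rw [this]
  refine MeasurableSet.iInter fun i => ?_
  by_cases hi : i = a
  · simp [hi]
  · simp only [ne_eq, hi, not_false_eq_true, forall_const]
    exact measurableSet_lt (by fun_prop) (by fun_prop)

lemma lintegral_pi_fin_prod (ν : Measure ℝ) [SigmaFinite ν] {n : ℕ} {f : Fin n → ℝ → ℝ≥0∞}
    (hf : ∀ i, Measurable (f i)) :
    ∫⁻ y, ∏ i, f i (y i) ∂(Measure.pi fun _ => ν) = ∏ i, ∫⁻ z, f i z ∂ν := by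
  induction n with
  | zero => simp
  | succ n ih =>
    have hm : ∀ i, Measurable fun y : Fin n → ℝ => f i.succ (y i) :=
      fun i => (hf _).comp (measurable_pi_apply i)
    have hm' : Measurable fun y : Fin (n + 1) → ℝ => ∏ i, f i (y i) :=
      Finset.measurable_prod _ fun i _ => (hf i).comp (measurable_pi_apply i)
    rw [← (measurePreserving_piFinSuccAbove (fun _ : Fin (n + 1) => ν) 0).symm.lintegral_comp hm']
    simp_rw [MeasurableEquiv.piFinSuccAbove_symm_apply, Fin.insertNthEquiv, Fin.prod_univ_succ,
      Fin.insertNth_zero, Equiv.coe_fn_mk, Fin.cons_succ, Fin.cons_zero]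
    rw [← ih fun i => hf i.succ]
    exact lintegral_prod_mul (hf 0).aemeasurable
      (Finset.measurable_prod _ fun i _ => hm i).aemeasurable

/-- Once the winning coordinate `y a = t` is fixed, the event constrains each other coordinate
separately to a half-line, so a product integrand factorizes. -/
lemma setLIntegral_strictMinSet_prod {n : ℕ} (ν : Measure ℝ) [SigmaFinite ν]
    {d : Fin (n + 1) → ℝ} (hd : ∀ i, 0 < d i) (a : Fin (n + 1)) {w : Fin (n + 1) → ℝ → ℝ≥0∞}
    (hw : ∀ i, Measurable (w i)) :
    ∫⁻ y in strictMinSet d a, ∏ i, w i (y i) ∂(Measure.pi fun _ => ν) =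
      ∫⁻ t, w a t * ∏ j : Fin n,
        ∫⁻ z in Set.Ioi (t * d a / d (a.succAbove j)), w (a.succAbove j) z ∂ν ∂ν := by
  have hm : Measurable fun y : Fin (n + 1) → ℝ => ∏ i, w i (y i) :=
    Finset.measurable_prod _ fun i _ => (hw i).comp (measurable_pi_apply i)
  have hp := (measurePreserving_piFinSuccAbove (fun _ : Fin (n + 1) => ν) a).symm
  rw [← lintegral_indicator (measurableSet_strictMinSet d a),
    ← hp.lintegral_comp (hm.indicator (measurableSet_strictMinSet d a)),
    lintegral_prod]
  swap
  · exact ((hm.indicator (measurableSet_strictMinSet d a)).comp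
      (MeasurableEquiv.measurable _)).aemeasurable
  refine lintegral_congr fun t => ?_
  have key : ∀ z : Fin n → ℝ, (strictMinSet d a).indicator (fun y => ∏ i, w i (y i))
      ((MeasurableEquiv.piFinSuccAbove (fun _ : Fin (n + 1) => ℝ) a).symm (t, z)) =
      w a t * ∏ j, (Set.Ioi (t * d a / d (a.succAbove j))).indicator (w (a.succAbove j)) (z j) := by
    intro z
    have e : (MeasurableEquiv.piFinSuccAbove (fun _ : Fin (n + 1) => ℝ) a).symm (t, z) =
        a.insertNth t z := rfl
    rw [e]
    by_cases h : a.insertNth (α := fun _ => ℝ) t z ∈ strictMinSet d a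
    · rw [Set.indicator_of_mem h, Fin.prod_univ_succAbove _ a]
      simp only [Fin.insertNth_apply_same, Fin.insertNth_apply_succAbove]
      congr 1
      refine Finset.prod_congr rfl fun j _ => ?_
      rw [Set.indicator_of_mem]
      have := h (a.succAbove j) (Fin.succAbove_ne a j)
      simp only [Fin.insertNth_apply_same, Fin.insertNth_apply_succAbove] at this
      rw [Set.mem_Ioi, div_lt_iff₀ (hd _)]
      exact this
    · rw [Set.indicator_of_notMem h]
      simp only [strictMinSet, Set.mem_ofPred_eq, not_forall] at h
      obtain ⟨i, hi, hlt⟩ := h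
      obtain ⟨j, rfl⟩ := Fin.exists_succAbove_eq hi
      simp only [Fin.insertNth_apply_same, Fin.insertNth_apply_succAbove] at hlt
      rw [Finset.prod_eq_zero (Finset.mem_univ j), mul_zero]
      rw [Set.indicator_of_notMem]
      rwa [Set.mem_Ioi, div_lt_iff₀ (hd _)]
  simp_rw [key]
  rw [lintegral_const_mul]
  swap
  · exact Finset.measurable_prod _ fun j _ =>
      ((hw (a.succAbove j)).indicator measurableSet_Ioi).comp (measurable_pi_apply j)
  congr 1
  rw [lintegral_pi_fin_prod ν fun j => (hw _).indicator measurableSet_Ioi]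
  simp_rw [lintegral_indicator measurableSet_Ioi]

lemma softmax_eq_inv {C : ℕ} (x : Fin C → ℝ) (a : Fin C) :
    softmax x a = (∑ i, Real.exp (x i - x a))⁻¹ := by
  simp_rw [Real.exp_sub, ← Finset.sum_div, inv_div, softmax]

lemma softmax_pos {C : ℕ} (x : Fin C → ℝ) (a : Fin C) : 0 < softmax x a := by
  have : 0 < ∑ j, Real.exp (x j) := Finset.sum_pos (fun _ _ => Real.exp_pos _) ⟨a, by simp⟩
  exact div_pos (Real.exp_pos _) this

lemma softmax_mul_exp_sub {C : ℕ} (x : Fin C → ℝ) (a c : Fin C) :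
    softmax x a * Real.exp (x c - x a) = softmax x c := by
  rw [softmax, softmax, Real.exp_sub]
  field_simp

/-- Affine factors cover both integrands needed later: the constant `1`, and a single coordinate `y
c`. The factors `exp(-u y)` only change the rate from `1` to `1 + u`. -/
lemma setLIntegral_strictMinSet_affine_exp {n : ℕ} (x : Fin (n + 1) → ℝ) (a : Fin (n + 1))
    {α β : Fin (n + 1) → ℝ} (hα : ∀ i, 0 ≤ α i) (hβ : ∀ i, 0 ≤ β i) {u : ℝ} (hu : 0 ≤ u) :
    ∫⁻ y in strictMinSet (fun i => Real.exp (-x i)) a,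
        ∏ i, ENNReal.ofReal ((α i * y i + β i) * Real.exp (-(u * y i)))
        ∂(Measure.pi fun _ => gammaMeasure 1 1) =
      ∫⁻ t in Set.Ioi 0, ENNReal.ofReal ((α a * t + β a) * Real.exp (-((1 + u) * (t / softmax x a)))
        * ∏ j : Fin n, ((α (a.succAbove j) * (t * Real.exp (x (a.succAbove j) - x a)) +
          α (a.succAbove j) / (1 + u) + β (a.succAbove j)) / (1 + u))) := by
  have hv : 0 < 1 + u := by linarith
  rw [setLIntegral_strictMinSet_prod (gammaMeasure 1 1) (fun i => Real.exp_pos _) a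
    (w := fun i z => ENNReal.ofReal ((α i * z + β i) * Real.exp (-(u * z))))
    (fun i => by fun_prop)]
  have hin : ∀ i (s : ℝ), 0 ≤ s → ∫⁻ z in Set.Ioi s,
      ENNReal.ofReal ((α i * z + β i) * Real.exp (-(u * z))) ∂gammaMeasure 1 1 =
      ENNReal.ofReal ((α i * s + α i / (1 + u) + β i) * Real.exp (-((1 + u) * s)) / (1 + u)) := by
    intro i s hs
    rw [setLIntegral_Ioi_gammaMeasure_one_one (by fun_prop) hs,
      ← lintegral_Ioi_add_mul_exp_neg_mul hs (hα i) (hβ i) hv]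
    refine lintegral_congr fun z => ?_
    rw [← ENNReal.ofReal_mul (Real.exp_pos _).le]
    congr 1
    rw [mul_left_comm, ← Real.exp_add]
    congr 2; ring
  have hd : ∀ (t : ℝ) (j : Fin n), t * Real.exp (-x a) / Real.exp (-x (a.succAbove j)) =
      t * Real.exp (x (a.succAbove j) - x a) := by
    intro t j
    rw [mul_div_assoc, ← Real.exp_sub]
    congr 2; ring
  have hpos : ∀ᵐ t ∂gammaMeasure 1 1,
      ENNReal.ofReal ((α a * t + β a) * Real.exp (-(u * t))) * ∏ j : Fin n,
        ∫⁻ z in Set.Ioi (t * Real.exp (-x a) / Real.exp (-x (a.succAbove j))),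
          ENNReal.ofReal ((α (a.succAbove j) * z + β (a.succAbove j)) * Real.exp (-(u * z)))
          ∂gammaMeasure 1 1 =
      ENNReal.ofReal ((α a * t + β a) * Real.exp (-(u * t)) *
        ∏ j : Fin n, ((α (a.succAbove j) * (t * Real.exp (x (a.succAbove j) - x a)) +
          α (a.succAbove j) / (1 + u) + β (a.succAbove j)) *
          Real.exp (-((1 + u) * (t * Real.exp (x (a.succAbove j) - x a)))) / (1 + u))) := by
    filter_upwards [ae_pos_gammaMeasure_one_one] with t ht
    have h1 : 0 ≤ (α a * t + β a) * Real.exp (-(u * t)) := by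
      have := hα a; have := hβ a; positivity
    rw [ENNReal.ofReal_mul h1, ENNReal.ofReal_prod_of_nonneg]
    · congr 1
      refine Finset.prod_congr rfl fun j _ => ?_
      rw [hd, hin _ _ (by positivity)]
    · intro j _
      have := hα (a.succAbove j); have := hβ (a.succAbove j)
      positivity
  rw [lintegral_congr_ae hpos, lintegral_gammaMeasure_one_one (by fun_prop)]
  refine lintegral_congr fun t => ?_
  rw [← ENNReal.ofReal_mul (Real.exp_pos _).le]
  congr 1
  -- The half-line thresholds, together with `t` itself, add up to `t / softmax x a`; this is where
  -- the softmax enters.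
  have hsum : ∑ j : Fin n, t * Real.exp (x (a.succAbove j) - x a) = t / softmax x a - t := by
    rw [softmax_eq_inv, Fin.sum_univ_succAbove _ a, ← Finset.mul_sum]
    simp; ring
  have hprod : ∏ j : Fin n, ((α (a.succAbove j) * (t * Real.exp (x (a.succAbove j) - x a)) +
          α (a.succAbove j) / (1 + u) + β (a.succAbove j)) *
          Real.exp (-((1 + u) * (t * Real.exp (x (a.succAbove j) - x a)))) / (1 + u)) =
      Real.exp (-((1 + u) * (t / softmax x a - t))) *
      ∏ j : Fin n, ((α (a.succAbove j) * (t * Real.exp (x (a.succAbove j) - x a)) +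
          α (a.succAbove j) / (1 + u) + β (a.succAbove j)) / (1 + u)) := by
    rw [← hsum, Finset.mul_sum, ← Finset.sum_neg_distrib, Real.exp_sum, ← Finset.prod_mul_distrib]
    exact Finset.prod_congr rfl fun j _ => by ring
  rw [hprod]
  have : Real.exp (-((1 + u) * (t / softmax x a))) =
      Real.exp (-t) * Real.exp (-(u * t)) * Real.exp (-((1 + u) * (t / softmax x a - t))) := by
    rw [← Real.exp_add, ← Real.exp_add]; congr 1; ring
  rw [this]
  ring

lemma measure_strictMinSet {n : ℕ} (x : Fin (n + 1) → ℝ) (a : Fin (n + 1)) :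
    (Measure.pi fun _ => gammaMeasure 1 1) (strictMinSet (fun i => Real.exp (-x i)) a) =
      ENNReal.ofReal (softmax x a) := by
  have h := setLIntegral_strictMinSet_affine_exp x a (α := 0) (β := 1) (fun _ => le_rfl)
    (fun _ => zero_le_one) (le_refl (0 : ℝ))
  simp only [Pi.zero_apply, Pi.one_apply, zero_mul, zero_add, neg_zero, Real.exp_zero, mul_one,
    ENNReal.ofReal_one, Finset.prod_const_one, one_mul, add_zero, div_one,
    lintegral_const, Measure.restrict_apply_univ] at h
  rw [h]
  have h2 := lintegral_Ioi_exp_neg_mul 0 (inv_pos.2 (softmax_pos x a))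
  simp only [mul_zero, neg_zero, Real.exp_zero, one_div, inv_inv] at h2
  rw [← h2]
  simp_rw [div_eq_inv_mul]

/-- The integrand is a product of affine-exponential factors with `α` the indicator of `c` and `β`
its complement. For a loser `c`, memorylessness makes its mean the threshold plus one more
exponential mean, which produces the two summands. -/
lemma setLIntegral_strictMinSet_mul_exp {n : ℕ} (x : Fin (n + 1) → ℝ) {a c : Fin (n + 1)}
    (hc : c ≠ a) {u : ℝ} (hu : 0 ≤ u) :
    ∫⁻ y in strictMinSet (fun i => Real.exp (-x i)) a,
        ENNReal.ofReal (y c * Real.exp (-(u * ∑ i, y i))) ∂(Measure.pi fun _ => gammaMeasure 1 1) =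
      ENNReal.ofReal ((softmax x a * softmax x c + softmax x a) * ((1 + u) ^ (n + 2))⁻¹) := by
  obtain ⟨j, rfl⟩ := Fin.exists_succAbove_eq hc
  have hv : 0 < 1 + u := by linarith
  have h := setLIntegral_strictMinSet_affine_exp x a
    (α := fun i => if i = a.succAbove j then 1 else 0)
    (β := fun i => if i = a.succAbove j then 0 else 1)
    (fun i => by split_ifs <;> simp) (fun i => by split_ifs <;> simp) hu
  have e1 : ∀ y : Fin (n + 1) → ℝ, ∏ i, ENNReal.ofReal
      (((if i = a.succAbove j then (1 : ℝ) else 0) * y i +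
        (if i = a.succAbove j then (0 : ℝ) else 1)) * Real.exp (-(u * y i))) =
      ENNReal.ofReal (y (a.succAbove j) * Real.exp (-(u * ∑ i, y i))) := by
    intro y
    have : ∀ i, ENNReal.ofReal (((if i = a.succAbove j then (1 : ℝ) else 0) * y i +
        (if i = a.succAbove j then (0 : ℝ) else 1)) * Real.exp (-(u * y i))) =
        (if i = a.succAbove j then ENNReal.ofReal (y i) else 1) *
          ENNReal.ofReal (Real.exp (-(u * y i))) := by
      intro i
      rw [ENNReal.ofReal_mul' (Real.exp_pos _).le]
      split_ifs <;> simp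
    simp_rw [this]
    rw [Finset.prod_mul_distrib, Finset.prod_ite_eq' Finset.univ, if_pos (Finset.mem_univ _),
      ← ENNReal.ofReal_prod_of_nonneg fun i _ => (Real.exp_pos _).le,
      ENNReal.ofReal_mul' (Real.exp_pos _).le, ← Real.exp_sum, Finset.sum_neg_distrib,
      ← Finset.mul_sum]
  simp_rw [e1] at h
  rw [h]
  have e2 : ∀ t : ℝ, ∏ j' : Fin n,
      (((if a.succAbove j' = a.succAbove j then (1 : ℝ) else 0) *
        (t * Real.exp (x (a.succAbove j') - x a)) +
        (if a.succAbove j' = a.succAbove j then (1 : ℝ) else 0) / (1 + u) +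
        (if a.succAbove j' = a.succAbove j then (0 : ℝ) else 1)) / (1 + u)) =
      (t * Real.exp (x (a.succAbove j) - x a) + 1 / (1 + u)) * ((1 + u) ^ n)⁻¹ := by
    intro t
    simp_rw [div_eq_mul_inv _ (1 + u), Finset.prod_mul_distrib]
    simp only [Finset.prod_const, Finset.card_univ, Fintype.card_fin, inv_pow]
    congr 1
    rw [Finset.prod_eq_single j]
    · simp
    · intro b _ hb
      simp [hb]
    · simp
  simp_rw [e2]
  have hs := softmax_pos x a
  -- What remains is an affine function of the winning value `t` against an exponential of rate `(1
  -- + u) / softmax x a`.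
  have h3 := lintegral_Ioi_add_mul_exp_neg_mul (t := 0)
    (α := Real.exp (x (a.succAbove j) - x a) * ((1 + u) ^ n)⁻¹)
    (β := 1 / (1 + u) * ((1 + u) ^ n)⁻¹) (v := (1 + u) / softmax x a)
    le_rfl (by positivity) (by positivity) (by positivity)
  convert! h3 using 1
  · refine lintegral_congr fun t => ?_
    rw [if_neg (Fin.succAbove_ne a j).symm, if_neg (Fin.succAbove_ne a j).symm]
    congr 1
    rw [show (1 + u) * (t / softmax x a) = (1 + u) / softmax x a * t by ring]
    ring
  · congr 1
    rw [← softmax_mul_exp_sub x a (a.succAbove j)]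
    simp
    field_simp
    ring

/-- The normalization is removed by `1/S = ∫ exp(-u S) du` over `u > 0` and Tonelli; the remaining
integral of `(1 + u)^-(n+2)` gives the factor `1/(n+1)`. -/
lemma setLIntegral_strictMinSet_div_sum {n : ℕ} (x : Fin (n + 1) → ℝ) {a c : Fin (n + 1)}
    (hc : c ≠ a) :
    ∫⁻ y in strictMinSet (fun i => Real.exp (-x i)) a,
        ENNReal.ofReal (y c / ∑ i, y i) ∂(Measure.pi fun _ => gammaMeasure 1 1) =
      ENNReal.ofReal ((softmax x a * softmax x c + softmax x a) / ((n + 1 : ℕ) : ℝ)) := by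
  have h1 : ∀ᵐ y : Fin (n + 1) → ℝ ∂((Measure.pi fun _ => gammaMeasure 1 1).restrict
      (strictMinSet (fun i => Real.exp (-x i)) a)), ENNReal.ofReal (y c / ∑ i, y i) =
      ∫⁻ u in Set.Ioi 0, ENNReal.ofReal (y c * Real.exp (-(u * ∑ i, y i))) := by
    filter_upwards [ae_restrict_of_ae (ae_pos_pi_gammaMeasure (n + 1))] with y hy
    have hS : 0 < ∑ i, y i := Finset.sum_pos (fun i _ => hy i) Finset.univ_nonempty
    have h2 := lintegral_Ioi_exp_neg_mul 0 hS
    simp_rw [ENNReal.ofReal_mul (hy c).le, mul_comm _ (∑ i, y i)]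
    rw [lintegral_const_mul _ (by fun_prop), h2, ← ENNReal.ofReal_mul (hy c).le]
    congr 1
    simp [div_eq_mul_inv]
  rw [lintegral_congr_ae h1, lintegral_lintegral_swap (by fun_prop)]
  have h2 : ∀ᵐ u : ℝ ∂(volume.restrict (Set.Ioi 0)),
      ∫⁻ y in strictMinSet (fun i => Real.exp (-x i)) a,
        ENNReal.ofReal (y c * Real.exp (-(u * ∑ i, y i)))
        ∂(Measure.pi fun _ : Fin (n + 1) => gammaMeasure 1 1) =
      ENNReal.ofReal (softmax x a * softmax x c + softmax x a) *
        ENNReal.ofReal (((1 + u) ^ (n + 2))⁻¹) := by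
    filter_upwards [ae_restrict_mem measurableSet_Ioi] with u hu
    have hsa := softmax_pos x a; have hsc := softmax_pos x c
    rw [setLIntegral_strictMinSet_mul_exp x hc (le_of_lt hu), ENNReal.ofReal_mul (by positivity)]
  rw [lintegral_congr_ae h2, lintegral_const_mul _ (by fun_prop), lintegral_Ioi_one_add_zpow]
  have hsa := softmax_pos x a; have hsc := softmax_pos x c
  rw [← ENNReal.ofReal_mul (by positivity), mul_one_div]

/-! ### Argmin events under the Dirichlet law. -/

lemma argmin_le {C : ℕ} [NeZero C] (f : Fin C → ℝ) (j : Fin C) : f (argmin f) ≤ f j := by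
  have h := Finset.min'_mem (Finset.univ.filter fun i => ∀ j, f i ≤ f j)
    (by obtain ⟨i, hi⟩ := Finite.exists_min f; exact ⟨i, by simpa using hi⟩)
  exact (Finset.mem_filter.1 h).2 j

lemma argmin_eq_of_forall_lt {C : ℕ} [NeZero C] {f : Fin C → ℝ} {a : Fin C}
    (h : ∀ i, i ≠ a → f a < f i) : argmin f = a := by
  by_contra hne
  exact (argmin_le f a).not_gt (h _ hne)

lemma argmin_eq_iff {C : ℕ} [NeZero C] (f : Fin C → ℝ) (a : Fin C) :
    argmin f = a ↔ (∀ j, f a ≤ f j) ∧ ∀ i, i < a → ¬ ∀ j, f i ≤ f j := by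
  constructor
  · rintro rfl
    refine ⟨argmin_le f, fun i hi h => ?_⟩
    exact (Finset.min'_le _ _ (Finset.mem_filter.2 ⟨Finset.mem_univ i, h⟩)).not_gt hi
  · rintro ⟨h1, h2⟩
    refine le_antisymm (Finset.min'_le _ _ (Finset.mem_filter.2 ⟨Finset.mem_univ a, h1⟩)) ?_
    by_contra h
    exact h2 _ (not_le.1 h) (argmin_le f)

lemma measurable_argmin {C : ℕ} [NeZero C] : Measurable (argmin : (Fin C → ℝ) → Fin C) := by
  refine measurable_to_countable' fun a => ?_
  have hm : ∀ i, MeasurableSet {f : Fin C → ℝ | ∀ j, f i ≤ f j} := fun i => by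
    have : {f : Fin C → ℝ | ∀ j, f i ≤ f j} = ⋂ j, {f | f i ≤ f j} := by ext; simp
    rw [this]
    exact MeasurableSet.iInter fun j => measurableSet_le (by fun_prop) (by fun_prop)
  have : argmin ⁻¹' {a} = {f : Fin C → ℝ | ∀ j, f a ≤ f j} ∩
      ⋂ i, {f | i < a → ¬ ∀ j, f i ≤ f j} := by
    ext f
    simp only [Set.mem_preimage, Set.mem_singleton_iff, argmin_eq_iff]
    simp
  rw [this]
  refine (hm a).inter (MeasurableSet.iInter fun i => ?_)
  by_cases hi : i < a
  · rw [show {f : Fin C → ℝ | i < a → ¬ ∀ j, f i ≤ f j} = {f | ∀ j, f i ≤ f j}ᶜ by ext; simp [hi]]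
    exact (hm i).compl
  · simp [hi]

lemma measurable_normalize {C : ℕ} : Measurable fun (y : Fin C → ℝ) i => y i / ∑ j, y j := by
  fun_prop

instance {C : ℕ} : IsProbabilityMeasure (dirichlet fun _ : Fin C => (1 : ℝ)) :=
  Measure.isProbabilityMeasure_map measurable_normalize.aemeasurable

instance {K C : ℕ} : IsProbabilityMeasure (dirichletProd K C) := by
  unfold dirichletProd; infer_instance

lemma ae_dirichlet_mem_simplex (C : ℕ) [NeZero C] :
    ∀ᵐ ϖ ∂(dirichlet fun _ : Fin C => (1 : ℝ)), (∀ i, 0 ≤ ϖ i) ∧ ∑ i, ϖ i = 1 := by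
  have hm : MeasurableSet {ϖ : Fin C → ℝ | (∀ i, 0 ≤ ϖ i) ∧ ∑ i, ϖ i = 1} := by
    refine MeasurableSet.inter ?_ (measurableSet_eq_fun (by fun_prop) (by fun_prop))
    have : {ϖ : Fin C → ℝ | ∀ i, 0 ≤ ϖ i} = ⋂ i, {ϖ | 0 ≤ ϖ i} := by ext; simp
    change MeasurableSet {ϖ : Fin C → ℝ | ∀ i, 0 ≤ ϖ i}
    rw [this]
    exact MeasurableSet.iInter fun i => measurableSet_le (by fun_prop) (by fun_prop)
  refine (ae_map_iff measurable_normalize.aemeasurable hm).2 ?_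
  filter_upwards [ae_pos_pi_gammaMeasure C] with y hy
  have hS : 0 < ∑ i, y i := Finset.sum_pos (fun i _ => hy i) Finset.univ_nonempty
  refine ⟨fun i => (div_pos (hy i) hS).le, ?_⟩
  rw [← Finset.sum_div, div_self hS.ne']

section

variable {C : ℕ} [NeZero C]

lemma measurable_argmin_mul_exp (x : Fin C → ℝ) :
    Measurable fun ϖ : Fin C → ℝ => argmin fun i => ϖ i * Real.exp (-x i) :=
  measurable_argmin.comp (by fun_prop)

lemma measurableSet_setOf_argmin (x : Fin C → ℝ) (a : Fin C) :
    MeasurableSet {ϖ : Fin C → ℝ | argmin (fun i => ϖ i * Real.exp (-x i)) = a} :=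
  measurable_argmin_mul_exp x (measurableSet_singleton a)

/-- Ties are null, by counting mass: each strict-minimum event lies almost surely in the
corresponding argmin event, and both families have total mass one because the softmax sums to one.
-/
lemma setOf_argmin_normalize_ae_eq (x : Fin C → ℝ) (a : Fin C) :
    {y : Fin C → ℝ | argmin (fun i => y i / (∑ j, y j) * Real.exp (-x i)) = a}
      =ᵐ[Measure.pi fun _ => gammaMeasure 1 1] strictMinSet (fun i => Real.exp (-x i)) a := by
  obtain ⟨n, rfl⟩ : ∃ n, C = n + 1 := Nat.exists_eq_succ_of_ne_zero (NeZero.ne C)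
  set μ : Measure (Fin (n + 1) → ℝ) := Measure.pi fun _ => gammaMeasure 1 1
  set A : Fin (n + 1) → Set (Fin (n + 1) → ℝ) := fun a =>
    {y | argmin (fun i => y i / (∑ j, y j) * Real.exp (-x i)) = a} with hA
  have hAm : ∀ a, MeasurableSet (A a) := fun a =>
    ((measurable_argmin_mul_exp x).comp measurable_normalize) (measurableSet_singleton a)
  have hsub : ∀ a, strictMinSet (fun i => Real.exp (-x i)) a ≤ᵐ[μ] A a := by
    intro a
    filter_upwards [ae_pos_pi_gammaMeasure (n + 1)] with y hy hyD
    have hS : 0 < ∑ i, y i := Finset.sum_pos (fun i _ => hy i) Finset.univ_nonempty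
    refine argmin_eq_of_forall_lt fun i hi => ?_
    rw [div_mul_eq_mul_div, div_mul_eq_mul_div]
    exact div_lt_div_of_pos_right (hyD i hi) hS
  have hle : ∀ a, μ (strictMinSet (fun i => Real.exp (-x i)) a) ≤ μ (A a) := fun a =>
    measure_mono_ae (hsub a)
  have hsum : ∑ a, μ (A a) = 1 := by
    rw [← measure_biUnion_finset _ fun a _ => hAm a]
    · rw [show (⋃ a ∈ Finset.univ, A a) = Set.univ by ext; simp [hA], measure_univ]
    · intro a _ b _ hab
      refine Set.disjoint_left.2 fun y hy hy' => hab ?_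
      exact (show _ = a from hy).symm.trans hy'
  have hsum' : ∑ a, μ (strictMinSet (fun i => Real.exp (-x i)) a) = 1 := by
    simp_rw [μ, measure_strictMinSet]
    rw [← ENNReal.ofReal_sum_of_nonneg fun a _ => softmax_nonneg _ _, sum_softmax,
      ENNReal.ofReal_one]
  -- A strict excess at one index could not be compensated at the others, so the two totals would
  -- differ.
  have heq : μ (A a) ≤ μ (strictMinSet (fun i => Real.exp (-x i)) a) := by
    by_contra hlt
    have := ENNReal.sum_lt_sum_of_nonempty (s := {a}) ⟨a, by simp⟩
      (f := fun a => μ (strictMinSet (fun i => Real.exp (-x i)) a)) (g := fun a => μ (A a))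
      (by simpa using hlt)
    have h2 : ∑ b ∈ Finset.univ.erase a, μ (strictMinSet (fun i => Real.exp (-x i)) b) ≤
        ∑ b ∈ Finset.univ.erase a, μ (A b) := Finset.sum_le_sum fun b _ => hle b
    rw [← Finset.add_sum_erase _ _ (Finset.mem_univ a)] at hsum hsum'
    have h3 : ∑ b ∈ Finset.univ.erase a, μ (A b) ≠ ∞ :=
      (ENNReal.sum_lt_top.2 fun b _ => measure_lt_top _ _).ne
    simp only [Finset.sum_singleton] at this
    have h4 := ENNReal.add_lt_add_of_lt_of_le (ne_top_of_le_ne_top h3 h2) this h2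
    rw [hsum, hsum'] at h4
    exact h4.false
  exact (ae_eq_of_ae_subset_of_measure_ge (hsub a) heq
    (measurableSet_strictMinSet _ _).nullMeasurableSet (measure_ne_top _ _)).symm

lemma dirichlet_setOf_argmin (x : Fin C → ℝ) (a : Fin C) :
    dirichlet (fun _ : Fin C => (1 : ℝ)) {ϖ | argmin (fun i => ϖ i * Real.exp (-x i)) = a} =
      ENNReal.ofReal (softmax x a) := by
  rw [dirichlet, Measure.map_apply measurable_normalize
    (measurableSet_setOf_argmin x a)]
  refine (measure_congr (setOf_argmin_normalize_ae_eq x a)).trans ?_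
  obtain ⟨n, rfl⟩ : ∃ n, C = n + 1 := Nat.exists_eq_succ_of_ne_zero (NeZero.ne C)
  exact measure_strictMinSet x a

lemma setLIntegral_dirichlet_argmin (x : Fin C → ℝ) {a c : Fin C} (hc : c ≠ a) :
    ∫⁻ ϖ in {ϖ | argmin (fun i => ϖ i * Real.exp (-x i)) = a}, ENNReal.ofReal (ϖ c)
        ∂(dirichlet fun _ : Fin C => (1 : ℝ)) =
      ENNReal.ofReal ((softmax x a * softmax x c + softmax x a) / (C : ℝ)) := by
  rw [dirichlet, setLIntegral_map (measurableSet_setOf_argmin x a)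
    (by fun_prop) measurable_normalize]
  refine (setLIntegral_congr (setOf_argmin_normalize_ae_eq x a)).trans ?_
  obtain ⟨n, rfl⟩ : ∃ n, C = n + 1 := Nat.exists_eq_succ_of_ne_zero (NeZero.ne C)
  exact setLIntegral_strictMinSet_div_sum x hc

lemma integrable_dirichlet_eval (c : Fin C) :
    Integrable (fun ϖ : Fin C → ℝ => ϖ c) (dirichlet fun _ : Fin C => (1 : ℝ)) := by
  refine Integrable.of_bound (measurable_pi_apply c).aestronglyMeasurable 1 ?_
  filter_upwards [ae_dirichlet_mem_simplex C] with ϖ h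
  rw [Real.norm_of_nonneg (h.1 c), ← h.2]
  exact Finset.single_le_sum (fun i _ => h.1 i) (Finset.mem_univ c)

lemma integral_dirichlet_argmin_of_ne (x : Fin C → ℝ) {a c : Fin C} (hc : c ≠ a) :
    ∫ ϖ in {ϖ | argmin (fun i => ϖ i * Real.exp (-x i)) = a}, (1 / (C : ℝ) - ϖ c)
        ∂(dirichlet fun _ : Fin C => (1 : ℝ)) = -(softmax x a * softmax x c) / C := by
  have hsa := softmax_pos x a; have hsc := softmax_pos x c
  rw [integral_sub (integrable_const _).integrableOn (integrable_dirichlet_eval c).integrableOn,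
    integral_const, integral_eq_lintegral_of_nonneg_ae, setLIntegral_dirichlet_argmin x hc,
    ENNReal.toReal_ofReal (by positivity), measureReal_restrict_apply_univ, measureReal_def,
    dirichlet_setOf_argmin, ENNReal.toReal_ofReal hsa.le, smul_eq_mul]
  · ring
  · exact ae_restrict_of_ae ((ae_dirichlet_mem_simplex C).mono fun ϖ h => h.1 c)
  · exact (measurable_pi_apply c).aestronglyMeasurable

/-- The diagonal case `c = a` needs no new integral: on the simplex the weights `1/C - ϖ i` sum to
zero, so it is minus the sum of the off-diagonal cases. -/
lemma integral_dirichlet_argmin (x : Fin C → ℝ) (a c : Fin C) :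
    ∫ ϖ in {ϖ | argmin (fun i => ϖ i * Real.exp (-x i)) = a}, (1 / (C : ℝ) - ϖ c)
        ∂(dirichlet fun _ : Fin C => (1 : ℝ)) =
      softmax x a * ((if a = c then 1 else 0) - softmax x c) / C := by
  by_cases hc : c = a
  · subst hc
    have h0 : ∑ i, ∫ ϖ in {ϖ | argmin (fun i => ϖ i * Real.exp (-x i)) = c}, (1 / (C : ℝ) - ϖ i)
        ∂(dirichlet fun _ : Fin C => (1 : ℝ)) = 0 := by
      rw [← integral_finsetSum]
      · refine integral_eq_zero_of_ae (ae_restrict_of_ae ?_)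
        filter_upwards [ae_dirichlet_mem_simplex C] with ϖ h
        have hC : (C : ℝ) ≠ 0 := Nat.cast_ne_zero.2 (NeZero.ne C)
        simp [Finset.sum_sub_distrib, h.2, hC]
      · exact fun i _ => ((integrable_const _).sub (integrable_dirichlet_eval i)).integrableOn
    rw [← Finset.add_sum_erase _ _ (Finset.mem_univ c),
      Finset.sum_congr rfl fun i hi => integral_dirichlet_argmin_of_ne x (Finset.ne_of_mem_erase hi),
      ← Finset.sum_div, Finset.sum_neg_distrib, ← Finset.mul_sum] at h0
    have h1 := sum_softmax x
    rw [← Finset.add_sum_erase _ _ (Finset.mem_univ c)] at h1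
    rw [← eq_sub_iff_add_eq'] at h1
    rw [h1] at h0
    rw [eq_neg_of_add_eq_zero_left h0, if_pos rfl]
    ring
  · rw [integral_dirichlet_argmin_of_ne x hc, if_neg (Ne.symm hc)]
    ring

end

/-! ### Swap symmetry and the mean of the ARSM quantities at a fixed state. -/

section

variable {K C : ℕ} [NeZero C]

lemma measurable_trueAction_uncurry :
    Measurable fun p : (Fin K → Fin C → ℝ) × (Fin K → Fin C → ℝ) => trueAction p.1 p.2 :=
  measurable_pi_lambda _ fun k => measurable_argmin.comp (by fun_prop)

lemma measurable_trueAction (x : Fin K → Fin C → ℝ) : Measurable (trueAction x) :=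
  measurable_trueAction_uncurry.comp (measurable_const.prodMk measurable_id)

lemma measurable_pseudoAction_uncurry (c j : Fin C) :
    Measurable fun p : (Fin K → Fin C → ℝ) × (Fin K → Fin C → ℝ) => pseudoAction p.1 p.2 c j := by
  refine measurable_pi_lambda _ fun k => ?_
  change Measurable fun p : (Fin K → Fin C → ℝ) × (Fin K → Fin C → ℝ) =>
    argmin fun i => p.2 k (Equiv.swap c j i) * Real.exp (-p.1 k i)
  exact measurable_argmin.comp (by fun_prop)

lemma measurable_pseudoAction (x : Fin K → Fin C → ℝ) (c j : Fin C) :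
    Measurable fun ϖ => pseudoAction x ϖ c j :=
  (measurable_pseudoAction_uncurry c j).comp (measurable_const.prodMk measurable_id)

lemma map_trueAction (x : Fin K → Fin C → ℝ) :
    (dirichletProd K C).map (trueAction x) = (actionPMF x).toMeasure := by
  refine Measure.ext_of_singleton fun a => ?_
  rw [Measure.map_apply (measurable_trueAction x) (measurableSet_singleton a),
    PMF.toMeasure_apply_singleton _ _ (measurableSet_singleton a), actionPMF,
    PMF.ofFintype_apply, ENNReal.ofReal_prod_of_nonneg fun k _ => softmax_nonneg _ _]
  have : trueAction x ⁻¹' {a} = Set.pi Set.univ fun k =>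
      {ϖ : Fin C → ℝ | argmin (fun i => ϖ i * Real.exp (-x k i)) = a k} := by
    ext ϖ
    simp [trueAction, funext_iff]
  rw [this, dirichletProd, Measure.pi_pi]
  exact Finset.prod_congr rfl fun k _ => dirichlet_setOf_argmin (x k) (a k)

-- The underlying exponentials are exchangeable and their sum is symmetric, so normalization
-- commutes with permuting coordinates.
omit [NeZero C] in
lemma measurePreserving_dirichlet_perm (e : Equiv.Perm (Fin C)) :
    MeasurePreserving (fun (ϖ : Fin C → ℝ) i => ϖ (e i)) (dirichlet fun _ : Fin C => (1 : ℝ))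
      (dirichlet fun _ : Fin C => (1 : ℝ)) := by
  have hm : Measurable fun (ϖ : Fin C → ℝ) i => ϖ (e i) := by fun_prop
  refine ⟨hm, ?_⟩
  have hp : (Measure.pi fun _ : Fin C => gammaMeasure 1 1).map (fun (ϖ : Fin C → ℝ) i => ϖ (e i)) =
      Measure.pi fun _ : Fin C => gammaMeasure 1 1 := by
    have h := (measurePreserving_piCongrLeft (fun _ : Fin C => gammaMeasure 1 1) e.symm).map_eq
    convert! h using 2
    ext ϖ i
    rw [MeasurableEquiv.coe_piCongrLeft]
    have := Equiv.piCongrLeft_apply_apply (P := fun _ : Fin C => ℝ) e.symm ϖ (e i)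
    simpa using this.symm
  conv_rhs => rw [dirichlet, ← hp, Measure.map_map measurable_normalize hm]
  rw [dirichlet, Measure.map_map hm measurable_normalize]
  congr 1
  ext y i
  simp only [Function.comp]
  rw [Equiv.sum_comp e y]

omit [NeZero C] in
lemma measurePreserving_dirichletProd_perm (e : Fin K → Equiv.Perm (Fin C)) :
    MeasurePreserving (fun (ϖ : Fin K → Fin C → ℝ) k i => ϖ k (e k i)) (dirichletProd K C)
      (dirichletProd K C) :=
  measurePreserving_pi _ _ fun k => measurePreserving_dirichlet_perm (e k)

lemma map_pseudoAction (x : Fin K → Fin C → ℝ) (c j : Fin C) :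
    (dirichletProd K C).map (fun ϖ => pseudoAction x ϖ c j) = (actionPMF x).toMeasure := by
  have h := measurePreserving_dirichletProd_perm (K := K) fun _ => Equiv.swap c j
  rw [← map_trueAction, ← h.map_eq, Measure.map_map (measurable_trueAction x) h.measurable, h.map_eq]
  rfl

/-- The probability of a joint action. -/
def actionProb (x : Fin K → Fin C → ℝ) (a : Action K C) : ℝ := ∏ k, softmax (x k) (a k)

/-- The partial derivative of `∑ a, q a * actionProb x a` with respect to the logit `x k c`. -/
def policyGrad (q : Action K C → ℝ) (x : Fin K → Fin C → ℝ) (k : Fin K) (c : Fin C) : ℝ :=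
  ∑ a, q a * (actionProb x a * ((if a k = c then 1 else 0) - softmax (x k) c))

/-- Infinitesimal form of the invariance of the softmax under a common shift of its logits; it is
the reason the baseline costs no bias. -/
lemma sum_policyGrad (q : Action K C → ℝ) (x : Fin K → Fin C → ℝ) (k : Fin K) :
    ∑ c, policyGrad q x k c = 0 := by
  unfold policyGrad
  rw [Finset.sum_comm]
  refine Finset.sum_eq_zero fun a _ => ?_
  rw [← Finset.mul_sum, ← Finset.mul_sum, Finset.sum_sub_distrib, sum_softmax]
  simp

lemma ae_dirichletProd_mem_simplex :
    ∀ᵐ ϖ ∂(dirichletProd K C), ∀ k, (∀ i, 0 ≤ ϖ k i) ∧ ∑ i, ϖ k i = 1 :=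
  ae_all_iff.2 fun k => (measurePreserving_eval
    (fun _ : Fin K => dirichlet fun _ : Fin C => (1 : ℝ)) k).quasiMeasurePreserving.ae
      (ae_dirichlet_mem_simplex C)

lemma ae_norm_sub_le (k : Fin K) (j : Fin C) :
    ∀ᵐ ϖ ∂(dirichletProd K C), ‖1 / (C : ℝ) - ϖ k j‖ ≤ 1 := by
  filter_upwards [ae_dirichletProd_mem_simplex] with ϖ h
  have h1 : ϖ k j ≤ 1 := (h k).2 ▸ Finset.single_le_sum (fun i _ => (h k).1 i) (Finset.mem_univ j)
  have h2 := (h k).1 j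
  have hC : (1 : ℝ) ≤ C := by exact_mod_cast NeZero.one_le
  have h3 : 1 / (C : ℝ) ≤ 1 := (div_le_one (by linarith)).2 hC
  have h4 : 0 ≤ 1 / (C : ℝ) := by positivity
  rw [Real.norm_eq_abs, abs_le]
  constructor <;> linarith

omit [NeZero C] in
lemma measurable_comp_mul (q : Action K C → ℝ) {f : (Fin K → Fin C → ℝ) → Action K C}
    (hf : Measurable f) (k : Fin K) (j : Fin C) :
    Measurable fun ϖ => q (f ϖ) * (1 / (C : ℝ) - ϖ k j) := by
  have hq : Measurable fun ϖ => q (f ϖ) := (measurable_of_finite q).comp hf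
  fun_prop

lemma integrable_comp_mul (q : Action K C → ℝ) {f : (Fin K → Fin C → ℝ) → Action K C}
    (hf : Measurable f) (k : Fin K) (j : Fin C) :
    Integrable (fun ϖ => q (f ϖ) * (1 / (C : ℝ) - ϖ k j)) (dirichletProd K C) := by
  refine Integrable.of_bound (measurable_comp_mul q hf k j).aestronglyMeasurable (∑ a, ‖q a‖) ?_
  filter_upwards [ae_norm_sub_le k j] with ϖ h
  rw [norm_mul]
  calc ‖q (f ϖ)‖ * ‖1 / (C : ℝ) - ϖ k j‖ ≤ ‖q (f ϖ)‖ * 1 := by gcongr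
    _ ≤ _ := by
      rw [mul_one]
      exact Finset.single_le_sum (f := fun a => ‖q a‖) (fun a _ => norm_nonneg _)
        (Finset.mem_univ _)

/-- After splitting by the value of the true action, the integrand is a product over dimensions:
dimension `k` carries the weight and yields the softmax derivative over `C`, every other dimension
yields a probability. -/
lemma integral_trueAction_mul (q : Action K C → ℝ) (x : Fin K → Fin C → ℝ) (k : Fin K)
    (c : Fin C) :
    ∫ ϖ, q (trueAction x ϖ) * (1 / (C : ℝ) - ϖ k c) ∂(dirichletProd K C) =
      policyGrad q x k c / C := by
  classical
  have hsplit : ∀ ϖ : Fin K → Fin C → ℝ, q (trueAction x ϖ) * (1 / (C : ℝ) - ϖ k c) =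
      ∑ a, q a * ((if trueAction x ϖ = a then 1 else 0) * (1 / (C : ℝ) - ϖ k c)) := by
    intro ϖ
    rw [Finset.sum_eq_single (trueAction x ϖ)]
    · simp
    · intro b _ hb; simp [hb.symm]
    · simp
  simp_rw [hsplit]
  rw [integral_finsetSum]
  swap
  · exact fun a _ => (integrable_comp_mul (fun b => if b = a then 1 else 0)
      (measurable_trueAction x) k c).const_mul _
  rw [policyGrad, Finset.sum_div]
  refine Finset.sum_congr rfl fun a _ => ?_
  rw [integral_const_mul, mul_div_assoc]
  congr 1
  have hprod : ∀ ϖ : Fin K → Fin C → ℝ,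
      (if trueAction x ϖ = a then (1 : ℝ) else 0) * (1 / (C : ℝ) - ϖ k c) =
      ∏ k', {ϖ : Fin C → ℝ | argmin (fun i => ϖ i * Real.exp (-x k' i)) = a k'}.indicator
        (fun ϖ => if k' = k then 1 / (C : ℝ) - ϖ c else 1) (ϖ k') := by
    intro ϖ
    by_cases h : trueAction x ϖ = a
    · have h' : ∀ k', argmin (fun i => ϖ k' i * Real.exp (-x k' i)) = a k' := congrFun h
      simp [h, h', Set.indicator]
    · rw [if_neg h, zero_mul]
      obtain ⟨k', hk'⟩ := Function.ne_iff.1 h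
      exact (Finset.prod_eq_zero (Finset.mem_univ k') (Set.indicator_of_notMem
        (s := {ϖ : Fin C → ℝ | argmin (fun i => ϖ i * Real.exp (-x k' i)) = a k'}) hk' _)).symm
  simp_rw [hprod]
  rw [dirichletProd, integral_fintype_prod_eq_prod]
  have hone : ∀ k', ∫ ϖ, {ϖ : Fin C → ℝ | argmin (fun i => ϖ i * Real.exp (-x k' i)) = a k'}.indicator
        (fun ϖ => if k' = k then 1 / (C : ℝ) - ϖ c else 1) ϖ ∂(dirichlet fun _ : Fin C => (1 : ℝ)) =
      softmax (x k') (a k') *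
        if k' = k then ((if a k = c then 1 else 0) - softmax (x k) c) / (C : ℝ) else 1 := by
    intro k'
    rw [integral_indicator (measurableSet_setOf_argmin _ _)]
    by_cases hk : k' = k
    · subst hk
      simp only [if_true]
      rw [integral_dirichlet_argmin, mul_div_assoc]
    · simp only [hk, if_false, mul_one]
      rw [integral_const, measureReal_restrict_apply_univ, measureReal_def,
        dirichlet_setOf_argmin, ENNReal.toReal_ofReal (softmax_nonneg _ _), smul_eq_mul, mul_one]
  simp_rw [hone]
  rw [Finset.prod_mul_distrib, Finset.prod_ite_eq' Finset.univ, if_pos (Finset.mem_univ _),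
    mul_div_assoc]
  rfl

lemma _root_.MeasureTheory.MeasurePreserving.integral_comp_of_measurable {α β : Type*}
    [MeasurableSpace α] [MeasurableSpace β] {μ : Measure α} {ν : Measure β} {T : α → β}
    (hT : MeasurePreserving T μ ν) {f : β → ℝ} (hf : Measurable f) :
    ∫ x, f (T x) ∂μ = ∫ y, f y ∂ν := by
  rw [← hT.map_eq, integral_map hT.measurable.aemeasurable hf.aestronglyMeasurable]

/-- Swapping `c` and `j` in all dimensions turns the pseudo action into the true action and moves
the weight from entry `j` to entry `c`. The value therefore does not depend on `j`. -/
lemma integral_pseudoAction_mul (q : Action K C → ℝ) (x : Fin K → Fin C → ℝ) (k : Fin K)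
    (c j : Fin C) :
    ∫ ϖ, q (pseudoAction x ϖ c j) * (1 / (C : ℝ) - ϖ k j) ∂(dirichletProd K C) =
      policyGrad q x k c / C := by
  have h := (measurePreserving_dirichletProd_perm (K := K) fun _ =>
    Equiv.swap c j).integral_comp_of_measurable
    (measurable_comp_mul q (measurable_trueAction x) k c)
  rw [← integral_trueAction_mul, ← h]
  simp only [Equiv.swap_apply_left]
  rfl

lemma denseG_eq_sum (q : Action K C → ℝ) (x ϖ : Fin K → Fin C → ℝ) (k : Fin K) (c : Fin C) :
    denseG q x ϖ k c = ∑ j, (q (pseudoAction x ϖ c j) * (1 / (C : ℝ) - ϖ k j) -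
      1 / (C : ℝ) * ∑ m, q (pseudoAction x ϖ m j) * (1 / (C : ℝ) - ϖ k j)) := by
  simp_rw [denseG, swapDiff, sub_mul _ _ (_ - _), mul_assoc, ← Finset.sum_mul]

lemma integral_denseG (q : Action K C → ℝ) (x : Fin K → Fin C → ℝ) (k : Fin K) (c : Fin C) :
    ∫ ϖ, denseG q x ϖ k c ∂(dirichletProd K C) = policyGrad q x k c := by
  have hi : ∀ m j : Fin C, Integrable
      (fun ϖ => q (pseudoAction x ϖ m j) * (1 / (C : ℝ) - ϖ k j)) (dirichletProd K C) :=
    fun m j => integrable_comp_mul q (measurable_pseudoAction x m j) k j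
  have hs : ∀ j : Fin C, Integrable
      (fun ϖ => 1 / (C : ℝ) * ∑ m, q (pseudoAction x ϖ m j) * (1 / (C : ℝ) - ϖ k j))
      (dirichletProd K C) := fun j => (integrable_finsetSum _ fun m _ => hi m j).const_mul _
  simp_rw [denseG_eq_sum]
  rw [integral_finsetSum]
  swap
  · exact fun j _ => (hi c j).sub (hs j)
  simp_rw [integral_sub (hi c _) (hs _), integral_const_mul,
    integral_finsetSum _ fun m _ => hi m _, integral_pseudoAction_mul, ← Finset.sum_div,
    sum_policyGrad]
  have hC : (C : ℝ) ≠ 0 := Nat.cast_ne_zero.2 (NeZero.ne C)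
  simp
  field_simp

/-- The event that all pseudo actions agree with the true action in dimension `k`. -/
def agreeSet (x : Fin K → Fin C → ℝ) (k : Fin K) : Set (Fin K → Fin C → ℝ) :=
  {ϖ | ∀ m j : Fin C, pseudoAction x ϖ m j k = trueAction x ϖ k}

lemma measurableSet_agreeSet_uncurry (k : Fin K) :
    MeasurableSet {p : (Fin K → Fin C → ℝ) × (Fin K → Fin C → ℝ) | p.2 ∈ agreeSet p.1 k} := by
  have : {p : (Fin K → Fin C → ℝ) × (Fin K → Fin C → ℝ) | p.2 ∈ agreeSet p.1 k} =
      ⋂ m, ⋂ j, {p | pseudoAction p.1 p.2 m j k = trueAction p.1 p.2 k} := by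
    ext; simp [agreeSet]
  rw [this]
  exact MeasurableSet.iInter fun m => MeasurableSet.iInter fun j => measurableSet_eq_fun
    ((measurable_pi_apply k).comp (measurable_pseudoAction_uncurry m j))
    ((measurable_pi_apply k).comp measurable_trueAction_uncurry)

lemma measurableSet_agreeSet (x : Fin K → Fin C → ℝ) (k : Fin K) :
    MeasurableSet (agreeSet x k) :=
  (measurable_const.prodMk measurable_id) (measurableSet_agreeSet_uncurry k)

/-- On this event the swap has no effect on the action in dimension `k`, so it can be carried out in
the other dimensions only; that partial swap leaves both the event and the weight unchanged. -/
lemma setIntegral_agreeSet_pseudoAction_mul (q : Action K C → ℝ) (x : Fin K → Fin C → ℝ)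
    (k : Fin K) (m j : Fin C) :
    ∫ ϖ in agreeSet x k, q (pseudoAction x ϖ m j) * (1 / (C : ℝ) - ϖ k j) ∂(dirichletProd K C) =
      ∫ ϖ in agreeSet x k, q (trueAction x ϖ) * (1 / (C : ℝ) - ϖ k j) ∂(dirichletProd K C) := by
  classical
  have hA := measurableSet_agreeSet x k
  -- The permutation is the identity in dimension `k` so that `ϖ k`, which alone decides membership
  -- in `agreeSet x k`, is untouched.
  have h := (measurePreserving_dirichletProd_perm (K := K) fun k' =>
    if k' = k then 1 else Equiv.swap m j).integral_comp_of_measurable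
    ((measurable_comp_mul q (measurable_trueAction x) k j).indicator hA)
  rw [← integral_indicator hA, ← integral_indicator hA, ← h]
  congr 1
  ext ϖ
  have hiff : (fun k' i => ϖ k' ((if k' = k then (1 : Equiv.Perm (Fin C)) else Equiv.swap m j) i)) ∈
      agreeSet x k ↔ ϖ ∈ agreeSet x k := by
    simp [agreeSet, pseudoAction, trueAction]
  by_cases hϖ : ϖ ∈ agreeSet x k
  · rw [Set.indicator_of_mem hϖ, Set.indicator_of_mem (hiff.2 hϖ)]
    simp only [if_true, Equiv.Perm.coe_one, id]
    congr 2
    ext1 k'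
    by_cases hk : k' = k
    · subst hk
      rw [hϖ m j]
      simp [trueAction]
    · simp [pseudoAction, trueAction, hk]
  · rw [Set.indicator_of_notMem hϖ, Set.indicator_of_notMem (hiff.not.2 hϖ)]

lemma integrable_denseG (q : Action K C → ℝ) (x : Fin K → Fin C → ℝ) (k : Fin K) (c : Fin C) :
    Integrable (fun ϖ => denseG q x ϖ k c) (dirichletProd K C) := by
  have hi : ∀ m j : Fin C, Integrable
      (fun ϖ => q (pseudoAction x ϖ m j) * (1 / (C : ℝ) - ϖ k j)) (dirichletProd K C) :=
    fun m j => integrable_comp_mul q (measurable_pseudoAction x m j) k j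
  simp_rw [denseG_eq_sum]
  exact integrable_finsetSum _ fun j _ =>
    (hi c j).sub ((integrable_finsetSum _ fun m _ => hi m j).const_mul _)

/-- For fixed `j` all pseudo actions `m` have the same weighted integral on this event, so each
equals their average. -/
lemma setIntegral_agreeSet_denseG (q : Action K C → ℝ) (x : Fin K → Fin C → ℝ) (k : Fin K)
    (c : Fin C) : ∫ ϖ in agreeSet x k, denseG q x ϖ k c ∂(dirichletProd K C) = 0 := by
  have hi : ∀ m j : Fin C, IntegrableOn
      (fun ϖ => q (pseudoAction x ϖ m j) * (1 / (C : ℝ) - ϖ k j)) (agreeSet x k)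
      (dirichletProd K C) :=
    fun m j => (integrable_comp_mul q (measurable_pseudoAction x m j) k j).integrableOn
  have hs : ∀ j : Fin C, IntegrableOn
      (fun ϖ => 1 / (C : ℝ) * ∑ m, q (pseudoAction x ϖ m j) * (1 / (C : ℝ) - ϖ k j))
      (agreeSet x k) (dirichletProd K C) :=
    fun j => (integrable_finsetSum _ fun m _ => hi m j).const_mul _
  simp_rw [denseG_eq_sum]
  rw [integral_finsetSum]
  swap
  · exact fun j _ => (hi c j).sub (hs j)
  refine Finset.sum_eq_zero fun j _ => ?_
  rw [integral_sub (hi c j) (hs j), integral_const_mul, integral_finsetSum _ fun m _ => hi m j]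
  simp_rw [setIntegral_agreeSet_pseudoAction_mul]
  have hC : (C : ℝ) ≠ 0 := Nat.cast_ne_zero.2 (NeZero.ne C)
  simp
  field_simp
  simp

lemma sparseG_eq_indicator (q : Action K C → ℝ) (x : Fin K → Fin C → ℝ) (k : Fin K)
    (c : Fin C) :
    (fun ϖ => sparseG q x ϖ k c) = (agreeSet x k)ᶜ.indicator fun ϖ => denseG q x ϖ k c := by
  classical
  ext ϖ
  by_cases h : ϖ ∈ agreeSet x k
  · rw [Set.indicator_of_notMem (by simpa using h), sparseG]
    exact if_pos h
  · rw [Set.indicator_of_mem h, sparseG]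
    exact if_neg h

lemma integral_sparseG (q : Action K C → ℝ) (x : Fin K → Fin C → ℝ) (k : Fin K) (c : Fin C) :
    ∫ ϖ, sparseG q x ϖ k c ∂(dirichletProd K C) = policyGrad q x k c := by
  rw [sparseG_eq_indicator, integral_indicator (measurableSet_agreeSet x k).compl,
    ← integral_denseG, ← integral_add_compl (measurableSet_agreeSet x k)
      (integrable_denseG q x k c), setIntegral_agreeSet_denseG, zero_add]

end

/-! ### Perturbed logits: probability ratios and derivatives. -/

section

variable {K C : ℕ} [NeZero C]

omit [NeZero C] in
lemma actionProb_nonneg (x : Fin K → Fin C → ℝ) (a : Action K C) : 0 ≤ actionProb x a :=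
  Finset.prod_nonneg fun _ _ => softmax_nonneg _ _

omit [NeZero C] in
lemma actionProb_pos (x : Fin K → Fin C → ℝ) (a : Action K C) : 0 < actionProb x a :=
  Finset.prod_pos fun _ _ => softmax_pos _ _

lemma actionPMF_apply (x : Fin K → Fin C → ℝ) (a : Action K C) :
    actionPMF x a = ENNReal.ofReal (actionProb x a) := rfl

lemma integral_actionPMF (x : Fin K → Fin C → ℝ) (f : Action K C → ℝ) :
    ∫ a, f a ∂(actionPMF x).toMeasure = ∑ a, actionProb x a * f a := by
  rw [PMF.integral_eq_sum]
  simp_rw [actionPMF_apply, ENNReal.toReal_ofReal (actionProb_nonneg _ _), smul_eq_mul]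

/-- The logits with `y` added to entry `(k, c)`. -/
def shiftLogit (x : Fin K → Fin C → ℝ) (k : Fin K) (c : Fin C) (y : ℝ) : Fin K → Fin C → ℝ :=
  fun k' c' => x k' c' + if k' = k ∧ c' = c then y else 0

omit [NeZero C] in
lemma shiftLogit_same (x : Fin K → Fin C → ℝ) (k : Fin K) (c : Fin C) (y : ℝ) :
    shiftLogit x k c y k = fun j => x k j + if j = c then y else 0 := by
  ext j; simp [shiftLogit]

omit [NeZero C] in
lemma shiftLogit_of_ne (x : Fin K → Fin C → ℝ) {k k' : Fin K} (hk : k' ≠ k) (c : Fin C) (y : ℝ) :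
    shiftLogit x k c y k' = x k' := by
  ext j; simp [shiftLogit, hk]

/-- Numerator and normalizing sum each contribute at most a factor `exp M`. -/
lemma softmax_le_of_abs_sub_le {v w : Fin C → ℝ} {M : ℝ} (h : ∀ i, |w i - v i| ≤ M) (i : Fin C) :
    softmax w i ≤ Real.exp (2 * M) * softmax v i := by
  have h1 : ∀ j, Real.exp (w j) ≤ Real.exp M * Real.exp (v j) := fun j => by
    rw [← Real.exp_add]
    exact Real.exp_le_exp.2 (by linarith [(abs_le.1 (h j)).2])
  have h2 : ∑ j, Real.exp (v j) ≤ Real.exp M * ∑ j, Real.exp (w j) := by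
    rw [Finset.mul_sum]
    refine Finset.sum_le_sum fun j _ => ?_
    rw [← Real.exp_add]
    exact Real.exp_le_exp.2 (by linarith [(abs_le.1 (h j)).1])
  have hv : 0 < ∑ j, Real.exp (v j) :=
    Finset.sum_pos (fun _ _ => Real.exp_pos _) Finset.univ_nonempty
  have hw : 0 < ∑ j, Real.exp (w j) :=
    Finset.sum_pos (fun _ _ => Real.exp_pos _) Finset.univ_nonempty
  rw [softmax, softmax, ← mul_div_assoc, div_le_div_iff₀ hw hv, two_mul, Real.exp_add]
  calc Real.exp (w i) * ∑ j, Real.exp (v j)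
      ≤ (Real.exp M * Real.exp (v i)) * (Real.exp M * ∑ j, Real.exp (w j)) := by
        gcongr
        exact h1 i
    _ = _ := by ring

lemma actionProb_shiftLogit_le (x : Fin K → Fin C → ℝ) (k : Fin K) (c : Fin C) (y : ℝ)
    (a : Action K C) :
    actionProb (shiftLogit x k c y) a ≤ Real.exp (2 * |y|) * actionProb x a := by
  have h : ∀ k', softmax (shiftLogit x k c y k') (a k') ≤
      (if k' = k then Real.exp (2 * |y|) else 1) * softmax (x k') (a k') := by
    intro k'
    by_cases hk : k' = k
    · rw [if_pos hk]
      refine softmax_le_of_abs_sub_le (fun i => ?_) _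
      simp only [shiftLogit, add_sub_cancel_left]
      split_ifs <;> simp
    · rw [if_neg hk, one_mul, shiftLogit_of_ne x hk]
  refine (Finset.prod_le_prod (fun _ _ => softmax_nonneg _ _) fun k' _ => h k').trans ?_
  rw [Finset.prod_mul_distrib, Finset.prod_ite_eq' Finset.univ, if_pos (Finset.mem_univ _)]
  rfl

lemma hasDerivAt_softmax (v : Fin C → ℝ) (c : Fin C) (b : ℝ) (i : Fin C) (y : ℝ) :
    HasDerivAt (fun y => softmax (fun j => v j + if j = c then y * b else 0) i)
      (b * (softmax (fun j => v j + if j = c then y * b else 0) i *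
        ((if i = c then 1 else 0) - softmax (fun j => v j + if j = c then y * b else 0) c))) y := by
  have h1 : ∀ j, HasDerivAt (fun y => Real.exp (v j + if j = c then y * b else 0))
      (Real.exp (v j + if j = c then y * b else 0) * if j = c then b else 0) y := by
    intro j
    refine HasDerivAt.exp ?_
    by_cases hj : j = c
    · simpa [hj] using ((hasDerivAt_id y).mul_const b).const_add (v c)
    · simpa [hj] using hasDerivAt_const y (v j)
  have hS : (∑ j, Real.exp (v j + if j = c then y * b else 0)) ≠ 0 :=
    (Finset.sum_pos (fun _ _ => Real.exp_pos _) Finset.univ_nonempty).ne'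
  have h2 := (h1 i).div (HasDerivAt.fun_sum fun j (_ : j ∈ Finset.univ) => h1 j) hS
  convert! h2 using 1
  simp only [softmax, mul_ite, mul_zero, Finset.sum_ite_eq', Finset.mem_univ, if_true]
  field_simp
  split_ifs <;> ring

lemma hasDerivAt_actionProb (x : Fin K → Fin C → ℝ) (k : Fin K) (c : Fin C) (b : ℝ)
    (a : Action K C) (y : ℝ) :
    HasDerivAt (fun y => actionProb (shiftLogit x k c (y * b)) a)
      (b * (actionProb (shiftLogit x k c (y * b)) a *
        ((if a k = c then 1 else 0) - softmax (shiftLogit x k c (y * b) k) c))) y := by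
  classical
  have h : ∀ k' ∈ Finset.univ, HasDerivAt (fun y => softmax (shiftLogit x k c (y * b) k') (a k'))
      (if k' = k then b * (softmax (shiftLogit x k c (y * b) k') (a k') *
        ((if a k = c then 1 else 0) - softmax (shiftLogit x k c (y * b) k) c)) else 0) y := by
    intro k' _
    by_cases hk : k' = k
    · subst hk
      simpa [shiftLogit_same] using hasDerivAt_softmax (x k') c b (a k') y
    · simpa [shiftLogit_of_ne x hk, hk] using hasDerivAt_const y (softmax (x k') (a k'))
  have h2 := HasDerivAt.fun_finsetProd h
  convert! h2 using 1
  simp only [smul_eq_mul, mul_ite, mul_zero, Finset.sum_ite_eq', Finset.mem_univ, if_true]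
  rw [actionProb, ← Finset.prod_erase_mul _ _ (Finset.mem_univ k)]
  ring

end

/-! ### One-time marginals and discounted occupation measures. -/

section

variable {S : Type*} [MeasurableSpace S] {K C : ℕ} [NeZero C]

/-- The law of `(s_n, a_n)` as a function of `(s_0, a_0)`. -/
def iter (P : Kernel (S × Action K C) S) (φ : LogitSeq S K C) :
    ℕ → Kernel (S × Action K C) (S × Action K C)
  | 0 => Kernel.id
  | n + 1 => step P φ n ∘ₖ iter P φ n

variable (P : Kernel (S × Action K C) S) [IsMarkovKernel P]

instance isMarkovKernel_iter (φ : LogitSeq S K C) (n : ℕ) : IsMarkovKernel (iter P φ n) := by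
  induction n with
  | zero => exact inferInstanceAs (IsMarkovKernel Kernel.id)
  | succ n ih => exact inferInstanceAs (IsMarkovKernel (step P φ n ∘ₖ iter P φ n))

omit [IsMarkovKernel P] in
lemma iter_add (φ : LogitSeq S K C) (t n : ℕ) :
    iter P φ (t + n) = iter P (φ.tail t) n ∘ₖ iter P φ t := by
  induction n with
  | zero => exact (Kernel.id_comp _).symm
  | succ n ih =>
    -- Step `n` of the tail chain draws its action from the policy at time `t + n + 1`, exactly as
    -- step `t + n` of the full chain does.
    change step P φ (t + n) ∘ₖ iter P φ (t + n) = step P (φ.tail t) n ∘ₖ iter P (φ.tail t) n ∘ₖ _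
    rw [ih, Kernel.comp_assoc]
    rfl

omit [IsMarkovKernel P] in
lemma iter_congr {φ ψ : LogitSeq S K C} {n : ℕ}
    (h : ∀ m, 0 < m → m ≤ n → policy φ m = policy ψ m) : iter P φ n = iter P ψ n := by
  induction n with
  | zero => rfl
  | succ n ih =>
    change step P φ n ∘ₖ _ = step P ψ n ∘ₖ _
    rw [ih fun m hm hmn => h m hm (hmn.trans n.le_succ), step, step, h (n + 1) n.succ_pos le_rfl]

lemma _root_.ProbabilityTheory.Kernel.comap_comp_measure {α β δ : Type*} [MeasurableSpace α]
    [MeasurableSpace β] [MeasurableSpace δ] (κ : Kernel β δ) {f : α → β} (hf : Measurable f)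
    (μ : Measure α) : κ.comap f hf ∘ₘ μ = κ ∘ₘ μ.map f := by
  ext s hs
  rw [Measure.bind_apply hs (Kernel.aemeasurable _), Measure.bind_apply hs (Kernel.aemeasurable _),
    lintegral_map (Kernel.measurable_coe κ hs) hf]
  rfl

/-- The return is a sum of functions of single times, so these marginals are all that is needed from
the trajectory law. -/
lemma map_eval_rollout (φ : LogitSeq S K C) (ν : Measure (S × Action K C))
    [IsProbabilityMeasure ν] (n : ℕ) :
    (rollout P φ ν).map (fun w => w n) = iter P φ n ∘ₘ ν := by
  induction n with
  | zero =>
    have h : (fun w : ℕ → S × Action K C => w 0) =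
        (fun u : (Π _ : Finset.Iic 0, S × Action K C) => u ⟨0, Finset.mem_Iic.2 le_rfl⟩) ∘
          Preorder.frestrictLe 0 := rfl
    rw [h, ← Measure.map_map (measurable_pi_apply _) (by fun_prop), rollout, Kernel.trajMeasure,
      Measure.map_comp _ _ (by fun_prop), Kernel.traj_map_frestrictLe, Kernel.partialTraj_self,
      Measure.id_comp, Measure.map_map (measurable_pi_apply _) (by fun_prop)]
    change Measure.map id ν = Kernel.id ∘ₘ ν
    rw [Measure.map_id, Measure.id_comp]
  | succ n ih =>
    have h := Kernel.map_frestrictLe_trajMeasure_compProd_eq_map_trajMeasure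
      (X := fun _ => S × Action K C) (κ := historyStep P φ) (μ₀ := ν) (a := n)
    have h2 := congrArg Measure.snd h
    rw [Measure.snd_compProd, Measure.snd_map_prodMk (by fun_prop)] at h2
    rw [rollout, ← h2, historyStep, Kernel.comap_comp_measure,
      Measure.map_map (measurable_pi_apply _) (by fun_prop)]
    change step P φ n ∘ₘ Measure.map (fun w => w n) (rollout P φ ν) = _
    rw [ih, Measure.comp_assoc]
    rfl

/-- The discounted occupation measure of the chain started from `(s_0, a_0)`. -/
def occupation (γ : ℝ) (φ : LogitSeq S K C) : Kernel (S × Action K C) (S × Action K C) where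
  toFun p := Measure.sum fun n => ENNReal.ofReal (γ ^ n) • iter P φ n p
  measurable' := by
    refine Measure.measurable_of_measurable_coe _ fun B hB => ?_
    simp_rw [Measure.sum_apply _ hB, Measure.smul_apply, smul_eq_mul]
    exact Measurable.tsum fun n => (Kernel.measurable_coe _ hB).const_mul _

omit [IsMarkovKernel P] in
lemma occupation_comp_measure (γ : ℝ) (φ : LogitSeq S K C) (ν : Measure (S × Action K C)) :
    occupation P γ φ ∘ₘ ν = Measure.sum fun n => ENNReal.ofReal (γ ^ n) • (iter P φ n ∘ₘ ν) := by
  ext B hB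
  rw [Measure.bind_apply hB (Kernel.aemeasurable _), Measure.sum_apply _ hB]
  simp_rw [Measure.smul_apply, smul_eq_mul, Measure.bind_apply hB (Kernel.aemeasurable _)]
  have : ∀ p, occupation P γ φ p B = ∑' n, ENNReal.ofReal (γ ^ n) * iter P φ n p B := fun p => by
    change Measure.sum _ B = _
    simp_rw [Measure.sum_apply _ hB, Measure.smul_apply, smul_eq_mul]
  simp_rw [this]
  rw [lintegral_tsum fun n => ((Kernel.measurable_coe _ hB).const_mul _).aemeasurable]
  simp_rw [lintegral_const_mul _ (Kernel.measurable_coe _ hB)]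

omit [IsMarkovKernel P] in
lemma occupation_comp_eq_add (γ : ℝ) (hγ : 0 ≤ γ) (φ : LogitSeq S K C)
    (ν : Measure (S × Action K C)) (t : ℕ) :
    occupation P γ φ ∘ₘ ν =
      (∑ n ∈ Finset.range t, ENNReal.ofReal (γ ^ n) • (iter P φ n ∘ₘ ν)) +
        ENNReal.ofReal (γ ^ t) • (occupation P γ (φ.tail t) ∘ₘ (iter P φ t ∘ₘ ν)) := by
  rw [occupation_comp_measure, occupation_comp_measure]
  ext B hB
  simp_rw [Measure.add_apply, Measure.finsetSum_apply, Measure.smul_apply, smul_eq_mul,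
    Measure.sum_apply _ hB, Measure.comp_assoc, Measure.smul_apply, smul_eq_mul, ← iter_add]
  rw [← ENNReal.summable.sum_add_tsum_nat_add' (k := t), ← ENNReal.tsum_mul_left]
  congr 1
  refine tsum_congr fun n => ?_
  rw [← mul_assoc, ← ENNReal.ofReal_mul (pow_nonneg hγ t), ← pow_add, add_comm n t]

-- Tonelli: absolute integrability of the return is integrability of `r` against the discounted sum
-- of marginals, which reduces later questions to measures on state-action pairs.
omit [NeZero C] in
lemma returnIntegrable_iff {γ : ℝ} (hγ : 0 ≤ γ) {r : S × Action K C → ℝ} (hr : Measurable r)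
    (m : Measure (ℕ → S × Action K C)) :
    ReturnIntegrable γ r m ↔
      Integrable r (Measure.sum fun n => ENNReal.ofReal (γ ^ n) • m.map fun w => w n) := by
  have h : ∀ w : ℕ → S × Action K C, ∀ n, ENNReal.ofReal (γ ^ n * |r (w n)|) =
      ENNReal.ofReal (γ ^ n) * ‖r (w n)‖ₑ := fun w n => by
    rw [ENNReal.ofReal_mul (pow_nonneg hγ n), Real.enorm_eq_ofReal_abs]
  have hm : ∀ n, Measurable fun w : ℕ → S × Action K C => ‖r (w n)‖ₑ := fun n =>
    (hr.comp (measurable_pi_apply n)).enorm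
  rw [ReturnIntegrable, Integrable, and_iff_right hr.aestronglyMeasurable, HasFiniteIntegral,
    lintegral_sum_measure]
  have hmap : ∀ n, ∫⁻ p, ‖r p‖ₑ ∂(m.map fun w => w n) = ∫⁻ w, ‖r (w n)‖ₑ ∂m := fun n =>
    lintegral_map hr.enorm (measurable_pi_apply n)
  simp_rw [h, lintegral_smul_measure, hmap]
  rw [lintegral_tsum fun n => ((hm n).const_mul _).aemeasurable]
  simp_rw [lintegral_const_mul _ (hm _), smul_eq_mul]

omit [NeZero C] in
lemma integral_return {γ : ℝ} (hγ : 0 ≤ γ) {r : S × Action K C → ℝ} (hr : Measurable r)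
    {m : Measure (ℕ → S × Action K C)} (h : ReturnIntegrable γ r m) :
    ∫ w, ∑' n, γ ^ n * r (w n) ∂m =
      ∫ p, r p ∂(Measure.sum fun n => ENNReal.ofReal (γ ^ n) • m.map fun w => w n) := by
  have hm : ∀ n, Measurable fun w : ℕ → S × Action K C => r (w n) := fun n =>
    hr.comp (measurable_pi_apply n)
  rw [integral_sum_measure ((returnIntegrable_iff hγ hr m).1 h), integral_tsum]
  · refine tsum_congr fun n => ?_
    rw [integral_const_mul, integral_smul_measure, integral_map
      (measurable_pi_apply n).aemeasurable hr.aestronglyMeasurable,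
      ENNReal.toReal_ofReal (pow_nonneg hγ n), smul_eq_mul]
  · exact fun n => ((hm n).const_mul _).aestronglyMeasurable
  · rw [← lintegral_tsum fun n => ((hm n).const_mul _).enorm.aemeasurable]
    refine (lt_of_le_of_lt (le_of_eq ?_) h).ne
    refine lintegral_congr fun w => tsum_congr fun n => ?_
    rw [Real.enorm_eq_ofReal_abs, abs_mul, abs_of_nonneg (pow_nonneg hγ n)]

lemma returnIntegrable_rollout_iff {γ : ℝ} (hγ : 0 ≤ γ) {r : S × Action K C → ℝ}
    (hr : Measurable r) (φ : LogitSeq S K C) (ν : Measure (S × Action K C))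
    [IsProbabilityMeasure ν] :
    ReturnIntegrable γ r (rollout P φ ν) ↔ Integrable r (occupation P γ φ ∘ₘ ν) := by
  simp_rw [returnIntegrable_iff hγ hr, map_eval_rollout, occupation_comp_measure]

lemma integral_return_rollout {γ : ℝ} (hγ : 0 ≤ γ) {r : S × Action K C → ℝ}
    (hr : Measurable r) (φ : LogitSeq S K C) (ν : Measure (S × Action K C))
    [IsProbabilityMeasure ν] (h : Integrable r (occupation P γ φ ∘ₘ ν)) :
    ∫ w, ∑' n, γ ^ n * r (w n) ∂(rollout P φ ν) = ∫ p, r p ∂(occupation P γ φ ∘ₘ ν) := by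
  rw [integral_return hγ hr ((returnIntegrable_rollout_iff P hγ hr φ ν).2 h)]
  simp_rw [map_eval_rollout, occupation_comp_measure]

lemma step_comp_measure (φ : LogitSeq S K C) (n : ℕ) (m : Measure (S × Action K C)) [SFinite m] :
    step P φ n ∘ₘ m = (P ∘ₘ m) ⊗ₘ policy φ (n + 1) := by
  ext B hB
  rw [Measure.bind_apply hB (Kernel.aemeasurable _), Measure.compProd_apply hB,
    Measure.lintegral_bind (Kernel.aemeasurable _)
      (Kernel.measurable_kernel_prodMk_left hB).aemeasurable]
  refine lintegral_congr fun p => ?_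
  rw [step, Kernel.compProd_apply hB]
  rfl

variable (μ₀ : Measure S) [IsProbabilityMeasure μ₀]

lemma stateLaw_eq_fst (φ : LogitSeq S K C) (t : ℕ) :
    stateLaw P μ₀ φ t = (iter P φ t ∘ₘ (μ₀ ⊗ₘ policy φ 0)).fst := by
  rw [← map_eval_rollout, Measure.fst, Measure.map_map measurable_fst (measurable_pi_apply t)]
  rfl

lemma stateLaw_zero (φ : LogitSeq S K C) : stateLaw P μ₀ φ 0 = μ₀ := by
  rw [stateLaw_eq_fst]
  change (Kernel.id ∘ₘ (μ₀ ⊗ₘ policy φ 0)).fst = μ₀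
  rw [Measure.id_comp, Measure.fst_compProd]

lemma stateLaw_succ (φ : LogitSeq S K C) (t : ℕ) :
    stateLaw P μ₀ φ (t + 1) = P ∘ₘ (iter P φ t ∘ₘ (μ₀ ⊗ₘ policy φ 0)) := by
  rw [stateLaw_eq_fst]
  change ((step P φ t ∘ₖ iter P φ t) ∘ₘ (μ₀ ⊗ₘ policy φ 0)).fst = _
  rw [← Measure.comp_assoc, step_comp_measure, Measure.fst_compProd]

instance isProbabilityMeasure_stateLaw (φ : LogitSeq S K C) (t : ℕ) :
    IsProbabilityMeasure (stateLaw P μ₀ φ t) := by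
  rw [stateLaw_eq_fst]; infer_instance

lemma iter_comp_eq_compProd (φ : LogitSeq S K C) (t : ℕ) :
    iter P φ t ∘ₘ (μ₀ ⊗ₘ policy φ 0) = stateLaw P μ₀ φ t ⊗ₘ policy φ t := by
  cases t with
  | zero =>
    rw [stateLaw_zero]
    exact Measure.id_comp
  | succ t =>
    change (step P φ t ∘ₖ iter P φ t) ∘ₘ (μ₀ ⊗ₘ policy φ 0) = _
    rw [← Measure.comp_assoc, step_comp_measure, stateLaw_succ]

omit [IsMarkovKernel P] [IsProbabilityMeasure μ₀] in
lemma iter_comp_congr {φ ψ : LogitSeq S K C} {n : ℕ} (h : ∀ m ≤ n, policy φ m = policy ψ m) :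
    iter P φ n ∘ₘ (μ₀ ⊗ₘ policy φ 0) = iter P ψ n ∘ₘ (μ₀ ⊗ₘ policy ψ 0) := by
  rw [iter_congr P fun m _ hm => h m hm, h 0 n.zero_le]

lemma stateLaw_congr {φ ψ : LogitSeq S K C} {t : ℕ} (h : ∀ m < t, policy φ m = policy ψ m) :
    stateLaw P μ₀ φ t = stateLaw P μ₀ ψ t := by
  cases t with
  | zero => rw [stateLaw_zero, stateLaw_zero]
  | succ t =>
    rw [stateLaw_succ, stateLaw_succ,
      iter_comp_congr P μ₀ fun m hm => h m (Nat.lt_succ_of_le hm)]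

-- The starting pair already contains the action at time `t`, so only policies at strictly later
-- times matter.
omit [IsMarkovKernel P] in
lemma occupation_tail_congr (γ : ℝ) {φ ψ : LogitSeq S K C} {t : ℕ}
    (h : ∀ m, t < m → policy φ m = policy ψ m) :
    occupation P γ (φ.tail t) = occupation P γ (ψ.tail t) := by
  have : ∀ n, iter P (φ.tail t) n = iter P (ψ.tail t) n := fun n =>
    iter_congr P fun m hm _ => h (t + m) (Nat.lt_add_of_pos_right hm)
  ext1 p
  change Measure.sum _ = Measure.sum _
  simp_rw [this]

/-- The discounted occupation measure when the policy is changed at time `t` only: the part before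
`t` does not change. -/
lemma occupation_comp_eq_of_policy_eq {γ : ℝ} (hγ : 0 ≤ γ) {φ ψ : LogitSeq S K C} {t : ℕ}
    (h : ∀ m ≠ t, policy ψ m = policy φ m) :
    occupation P γ ψ ∘ₘ (μ₀ ⊗ₘ policy ψ 0) =
      (∑ n ∈ Finset.range t, ENNReal.ofReal (γ ^ n) • (iter P φ n ∘ₘ (μ₀ ⊗ₘ policy φ 0))) +
        ENNReal.ofReal (γ ^ t) •
          (occupation P γ (φ.tail t) ∘ₘ (stateLaw P μ₀ φ t ⊗ₘ policy ψ t)) := by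
  rw [occupation_comp_eq_add P γ hγ ψ _ t, iter_comp_eq_compProd,
    stateLaw_congr P μ₀ fun m hm => h m hm.ne, occupation_tail_congr P γ fun m hm => h m hm.ne']
  congr 1
  refine Finset.sum_congr rfl fun n hn => ?_
  rw [iter_comp_congr P μ₀ fun m hm => h m (hm.trans_lt (Finset.mem_range.1 hn)).ne]

end

/-! ### Domination and integration for composed kernels. -/

lemma _root_.MeasureTheory.Measure.compProd_le_smul {α β : Type*} [MeasurableSpace α]
    [MeasurableSpace β] (μ : Measure α) [SFinite μ] {κ η : Kernel α β} [IsSFiniteKernel κ]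
    [IsSFiniteKernel η] {b : ℝ≥0∞} (h : ∀ s, κ s ≤ b • η s) : μ ⊗ₘ κ ≤ b • (μ ⊗ₘ η) := by
  refine Measure.le_iff.2 fun B hB => ?_
  rw [Measure.smul_apply, smul_eq_mul, Measure.compProd_apply hB, Measure.compProd_apply hB,
    ← lintegral_const_mul _ (Kernel.measurable_kernel_prodMk_left hB)]
  exact lintegral_mono fun s => h s _

lemma _root_.MeasureTheory.Measure.comp_le_smul {α β : Type*} [MeasurableSpace α]
    [MeasurableSpace β] {μ ν : Measure α} (κ : Kernel α β) {b : ℝ≥0∞} (h : μ ≤ b • ν) :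
    κ ∘ₘ μ ≤ b • (κ ∘ₘ ν) := by
  refine Measure.le_iff.2 fun B hB => ?_
  rw [Measure.smul_apply, Measure.bind_apply hB (Kernel.aemeasurable _),
    Measure.bind_apply hB (Kernel.aemeasurable _), ← lintegral_smul_measure]
  exact lintegral_mono' h le_rfl

lemma _root_.MeasureTheory.Measure.integral_comp_kernel {α β : Type*} [MeasurableSpace α]
    [MeasurableSpace β] {μ : Measure α} {κ : Kernel α β} {f : β → ℝ}
    (h : Integrable f (κ ∘ₘ μ)) : ∫ y, f y ∂(κ ∘ₘ μ) = ∫ x, ∫ y, f y ∂κ x ∂μ := by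
  rw [Measure.comp_eq_comp_const_apply] at h ⊢
  rw [Kernel.integral_comp h, Kernel.const_apply]

lemma _root_.MeasureTheory.Measure.integrable_integral_of_integrable_comp {α β : Type*}
    [MeasurableSpace α] [MeasurableSpace β] {μ : Measure α} {κ : Kernel α β} {f : β → ℝ}
    (h : Integrable f (κ ∘ₘ μ)) : Integrable (fun x => ∫ y, f y ∂κ x) μ := by
  rw [Measure.comp_eq_comp_const_apply] at h
  exact h.integral_comp

/-! ### Averaging over the state at time `t`. -/

section

variable {S : Type*} [MeasurableSpace S] {K C : ℕ}

lemma perturb_val_same (φ : LogitSeq S K C) (t : ℕ) (k : Fin K) (c : Fin C) (h : S → ℝ)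
    (hh : Measurable h) (x : ℝ) (s : S) :
    (φ.perturb t k c h hh x).val t s = shiftLogit (φ.val t s) k c (x * h s) := by
  ext k' c'
  simp [LogitSeq.perturb, shiftLogit]

variable [NeZero C]

lemma policy_apply (φ : LogitSeq S K C) (t : ℕ) (s : S) :
    policy φ t s = (actionPMF (φ.val t s)).toMeasure := rfl

lemma policy_perturb_of_ne (φ : LogitSeq S K C) {t n : ℕ} (hn : n ≠ t) (k : Fin K) (c : Fin C)
    (h : S → ℝ) (hh : Measurable h) (x : ℝ) :
    policy (φ.perturb t k c h hh x) n = policy φ n := by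
  have : (φ.perturb t k c h hh x).val n = φ.val n := by
    ext s k' c'
    simp [LogitSeq.perturb, hn]
  ext1 s
  rw [policy_apply, policy_apply, this]

/-- The bound is uniform in `s` because `h` is bounded; it carries integrability of `r` from `φ` to
the perturbed policies. -/
lemma policy_perturb_le (φ : LogitSeq S K C) (t : ℕ) (k : Fin K) (c : Fin C)
    (h : S → ℝ) (hh : Measurable h) {B : ℝ} (hB : ∀ s, |h s| ≤ B) (x : ℝ) (s : S) :
    policy (φ.perturb t k c h hh x) t s ≤
      ENNReal.ofReal (Real.exp (2 * (|x| * B))) • policy φ t s := by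
  refine Measure.le_iff.2 fun A hA => ?_
  rw [policy_apply, policy_apply, Measure.smul_apply, smul_eq_mul, PMF.toMeasure_apply_fintype,
    PMF.toMeasure_apply_fintype, Finset.mul_sum]
  refine Finset.sum_le_sum fun a _ => ?_
  by_cases ha : a ∈ A
  · rw [Set.indicator_of_mem ha, Set.indicator_of_mem ha, actionPMF_apply, actionPMF_apply,
      ← ENNReal.ofReal_mul (Real.exp_pos _).le, perturb_val_same]
    refine ENNReal.ofReal_le_ofReal ((actionProb_shiftLogit_le _ _ _ _ _).trans ?_)
    rw [abs_mul]
    have := actionProb_nonneg (φ.val t s) a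
    have := hB s
    gcongr
  · simp [Set.indicator_of_notMem ha]

/-- Softmax probabilities are strictly positive, so no single action is null. -/
lemma forall_of_ae_policy {φ : LogitSeq S K C} {t : ℕ} {s : S} {p : Action K C → Prop}
    (h : ∀ᵐ a ∂(policy φ t s), p a) (a : Action K C) : p a := by
  by_contra ha
  have h0 : policy φ t s {a} = 0 := measure_mono_null (by simpa using ha) h
  rw [policy_apply, PMF.toMeasure_apply_singleton _ _ (measurableSet_singleton a),
    actionPMF_apply, ENNReal.ofReal_eq_zero] at h0
  exact h0.not_gt (actionProb_pos _ _)

lemma measurable_prodMk_pseudoAction (φ : LogitSeq S K C) (t : ℕ) (c j : Fin C) :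
    Measurable fun p : S × (Fin K → Fin C → ℝ) => (p.1, pseudoAction (φ.val t p.1) p.2 c j) := by
  refine measurable_fst.prodMk (measurable_pi_lambda _ fun k => ?_)
  change Measurable fun p : S × (Fin K → Fin C → ℝ) =>
    argmin fun i => p.2 k (Equiv.swap c j i) * Real.exp (-φ.val t p.1 k i)
  have hφ : ∀ i, Measurable fun p : S × (Fin K → Fin C → ℝ) => φ.val t p.1 k i := fun i =>
    (measurable_pi_apply i).comp ((measurable_pi_apply k).comp
      ((φ.measurable_val t).comp measurable_fst))
  exact measurable_argmin.comp (by fun_prop)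

/-- A pseudo action is distributed like the true one given the state. Integrability of `q` under the
policy thus transfers to every term of `denseG`, the remaining weights being bounded. -/
lemma map_prod_pseudoAction (ρ : Measure S) [IsProbabilityMeasure ρ] (φ : LogitSeq S K C) (t : ℕ)
    (c j : Fin C) :
    (ρ.prod (dirichletProd K C)).map (fun p => (p.1, pseudoAction (φ.val t p.1) p.2 c j)) =
      ρ ⊗ₘ policy φ t := by
  have hm := measurable_prodMk_pseudoAction φ t c j
  ext B hB
  rw [Measure.map_apply hm hB, Measure.prod_apply (hm hB), Measure.compProd_apply hB]
  refine lintegral_congr fun s => ?_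
  rw [policy_apply, ← map_pseudoAction (φ.val t s) c j,
    Measure.map_apply (measurable_pseudoAction _ _ _) (measurable_prodMk_left hB)]
  rfl

variable {ρ : Measure S} [IsProbabilityMeasure ρ] {φ : LogitSeq S K C} {t : ℕ}
  {q : S × Action K C → ℝ}

lemma integrable_denseG_prod (hq : Integrable q (ρ ⊗ₘ policy φ t)) (k : Fin K) (c : Fin C) :
    Integrable (fun p : S × (Fin K → Fin C → ℝ) =>
      denseG (fun a => q (p.1, a)) (φ.val t p.1) p.2 k c) (ρ.prod (dirichletProd K C)) := by
  have hi : ∀ m j : Fin C, Integrable (fun p : S × (Fin K → Fin C → ℝ) =>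
      q (p.1, pseudoAction (φ.val t p.1) p.2 m j) * (1 / (C : ℝ) - p.2 k j))
      (ρ.prod (dirichletProd K C)) := by
    intro m j
    have hm := measurable_prodMk_pseudoAction φ t m j
    rw [← map_prod_pseudoAction ρ φ t m j] at hq
    have h1 := hq.comp_measurable hm
    have hw : Measurable fun p : S × (Fin K → Fin C → ℝ) => 1 / (C : ℝ) - p.2 k j := by fun_prop
    exact h1.mul_bdd hw.aestronglyMeasurable
      (Measure.quasiMeasurePreserving_snd.ae (ae_norm_sub_le k j))
  simp_rw [denseG_eq_sum]
  exact integrable_finsetSum _ fun j _ =>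
    (hi c j).sub ((integrable_finsetSum _ fun m _ => hi m j).const_mul _)

lemma integrable_sparseG_prod (hq : Integrable q (ρ ⊗ₘ policy φ t)) (k : Fin K) (c : Fin C) :
    Integrable (fun p : S × (Fin K → Fin C → ℝ) =>
      sparseG (fun a => q (p.1, a)) (φ.val t p.1) p.2 k c) (ρ.prod (dirichletProd K C)) := by
  have hA : MeasurableSet {p : S × (Fin K → Fin C → ℝ) | p.2 ∈ agreeSet (φ.val t p.1) k} :=
    (((φ.measurable_val t).comp measurable_fst).prodMk measurable_snd)
      (measurableSet_agreeSet_uncurry k)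
  refine ((integrable_denseG_prod hq k c).indicator hA.compl).congr
    (Filter.Eventually.of_forall fun p => ?_)
  exact (congrFun (sparseG_eq_indicator (fun a => q (p.1, a)) (φ.val t p.1) k c) p.2).symm

omit [NeZero C] in
lemma measurable_actionProb (a : Action K C) :
    Measurable fun x : Fin K → Fin C → ℝ => actionProb x a :=
  Finset.measurable_prod _ fun k _ => (measurable_softmax (a k)).comp (measurable_pi_apply k)

omit [NeZero C] in
lemma measurable_shiftLogit_val (φ : LogitSeq S K C) (t : ℕ) (k : Fin K) (c : Fin C)
    {h : S → ℝ} (hh : Measurable h) (x : ℝ) :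
    Measurable fun s => shiftLogit (φ.val t s) k c (x * h s) := by
  have := (φ.perturb t k c h hh x).measurable_val t
  simpa only [perturb_val_same] using (show Measurable fun s => _ from this)

/-- Dominated differentiation on `|x| < 1`. There the probabilities are at most `exp (2 * B)` times
the unperturbed ones, and the score factor `1{a k = c} - softmax` is at most `1` in absolute value.
-/
lemma hasDerivAt_integral_perturb (hqm : Measurable q) (hq : Integrable q (ρ ⊗ₘ policy φ t))
    (k : Fin K) (c : Fin C) {h : S → ℝ} (hh : Measurable h) {B : ℝ} (hB : ∀ s, |h s| ≤ B) :
    HasDerivAt (fun x => ∫ s, ∑ a, actionProb (shiftLogit (φ.val t s) k c (x * h s)) a * q (s, a)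
        ∂ρ)
      (∫ s, h s * policyGrad (fun a => q (s, a)) (φ.val t s) k c ∂ρ) 0 := by
  have hqa : ∀ a, Measurable fun s => q (s, a) := fun a => hqm.comp measurable_prodMk_right
  have hp : ∀ (x : ℝ) a, Measurable fun s => actionProb (shiftLogit (φ.val t s) k c (x * h s)) a :=
    fun x a => (measurable_actionProb a).comp (measurable_shiftLogit_val φ t k c hh x)
  have hsm : ∀ x : ℝ, Measurable fun s => softmax (shiftLogit (φ.val t s) k c (x * h s) k) c :=
    fun x => (measurable_softmax c).comp
      ((measurable_pi_apply k).comp (measurable_shiftLogit_val φ t k c hh x))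
  have hzero : ∀ s, shiftLogit (φ.val t s) k c (0 * h s) = φ.val t s := fun s => by
    ext; simp [shiftLogit]
  have hnorm : Integrable (fun s => ∑ a, actionProb (φ.val t s) a * |q (s, a)|) ρ := by
    have := ((Measure.integrable_compProd_iff hq.1).1 hq).2
    simpa only [policy_apply, integral_actionPMF, Real.norm_eq_abs] using this
  have hB0 : ∀ s : S, 0 ≤ B := fun s => (abs_nonneg _).trans (hB s)
  have key := hasDerivAt_integral_of_dominated_loc_of_deriv_le (μ := ρ) (x₀ := (0 : ℝ))
    (s := Metric.ball 0 1)
    (F := fun x s => ∑ a, actionProb (shiftLogit (φ.val t s) k c (x * h s)) a * q (s, a))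
    (F' := fun x s => ∑ a, h s * (actionProb (shiftLogit (φ.val t s) k c (x * h s)) a *
      ((if a k = c then 1 else 0) - softmax (shiftLogit (φ.val t s) k c (x * h s) k) c)) * q (s, a))
    (bound := fun s => (B * Real.exp (2 * B)) * ∑ a, actionProb (φ.val t s) a * |q (s, a)|)
    (Metric.ball_mem_nhds 0 one_pos)
    (Filter.Eventually.of_forall fun x => (Finset.measurable_sum _ fun a _ =>
      (hp x a).mul (hqa a)).aestronglyMeasurable)
    ?_ ?_ ?_ (hnorm.const_mul _) ?_
  · convert! key.2 using 1
    refine integral_congr_ae (Filter.Eventually.of_forall fun s => ?_)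
    simp only [hzero, policyGrad]
    rw [Finset.mul_sum]
    exact Finset.sum_congr rfl fun a _ => by ring
  · refine hnorm.mono (Finset.measurable_sum _ fun a _ =>
      (hp 0 a).mul (hqa a)).aestronglyMeasurable (Filter.Eventually.of_forall fun s => ?_)
    simp only [hzero]
    refine (norm_sum_le _ _).trans (le_trans (Finset.sum_le_sum fun a _ => ?_) (le_abs_self _))
    rw [norm_mul, Real.norm_of_nonneg (actionProb_nonneg _ _), Real.norm_eq_abs]
  · exact (Finset.measurable_sum _ fun a _ =>
      (hh.mul ((hp 0 a).mul (measurable_const.sub (hsm 0)))).mul (hqa a)).aestronglyMeasurable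
  · refine Filter.Eventually.of_forall fun s x hx => ?_
    refine (norm_sum_le _ _).trans ?_
    rw [Finset.mul_sum]
    refine Finset.sum_le_sum fun a _ => ?_
    have hx1 : |x| ≤ 1 := by simpa using (mem_ball_zero_iff.1 hx).le
    have h1 : actionProb (shiftLogit (φ.val t s) k c (x * h s)) a ≤
        Real.exp (2 * B) * actionProb (φ.val t s) a := by
      refine (actionProb_shiftLogit_le _ _ _ _ _).trans ?_
      have h3 : |x * h s| ≤ B := by
        rw [abs_mul]
        calc |x| * |h s| ≤ 1 * B := by gcongr; exact hB s
          _ = B := one_mul B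
      have := actionProb_nonneg (φ.val t s) a
      gcongr
    have h2 : |(if a k = c then (1 : ℝ) else 0) -
        softmax (shiftLogit (φ.val t s) k c (x * h s) k) c| ≤ 1 := by
      have e1 := softmax_nonneg (shiftLogit (φ.val t s) k c (x * h s) k) c
      have e2 : softmax (shiftLogit (φ.val t s) k c (x * h s) k) c ≤ 1 := by
        rw [← sum_softmax (shiftLogit (φ.val t s) k c (x * h s) k)]
        exact Finset.single_le_sum (fun i _ => softmax_nonneg _ i) (Finset.mem_univ c)
      rw [abs_le]
      split_ifs <;> constructor <;> linarith
    have h4 := actionProb_nonneg (shiftLogit (φ.val t s) k c (x * h s)) a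
    rw [norm_mul, norm_mul, norm_mul, Real.norm_of_nonneg h4]
    simp only [Real.norm_eq_abs]
    have := hB0 s
    calc |h s| * (actionProb (shiftLogit (φ.val t s) k c (x * h s)) a *
          |(if a k = c then (1 : ℝ) else 0) -
            softmax (shiftLogit (φ.val t s) k c (x * h s) k) c|) * |q (s, a)|
        ≤ B * ((Real.exp (2 * B) * actionProb (φ.val t s) a) * 1) * |q (s, a)| := by
          have := actionProb_nonneg (φ.val t s) a
          gcongr
          exact hB s
      _ = _ := by ring
  · refine Filter.Eventually.of_forall fun s x _ => ?_
    exact HasDerivAt.fun_sum fun a _ => (hasDerivAt_actionProb _ _ _ _ _ _).mul_const _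

end

/-! ### Integrability of the perturbed returns, and `J` and `Q` through occupation measures. -/

section

variable {S : Type*} [MeasurableSpace S] {K C : ℕ} [NeZero C]
  (P : Kernel (S × Action K C) S) [IsMarkovKernel P] (μ₀ : Measure S) [IsProbabilityMeasure μ₀]
  {γ : ℝ} {r : S × Action K C → ℝ} {φ : LogitSeq S K C}

lemma integrable_occupation_tail (hr : Measurable r) (hγ : 0 < γ)
    (hJ : ReturnIntegrable γ r (trajLaw P μ₀ φ)) (t : ℕ) :
    Integrable r (∑ n ∈ Finset.range t,
      ENNReal.ofReal (γ ^ n) • (iter P φ n ∘ₘ (μ₀ ⊗ₘ policy φ 0))) ∧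
    Integrable r (occupation P γ (φ.tail t) ∘ₘ (stateLaw P μ₀ φ t ⊗ₘ policy φ t)) := by
  have h := (returnIntegrable_rollout_iff P hγ.le hr φ (μ₀ ⊗ₘ policy φ 0)).1 hJ
  rw [occupation_comp_eq_of_policy_eq P μ₀ hγ.le (φ := φ) (t := t) fun _ _ => rfl,
    integrable_add_measure] at h
  -- Positivity of `γ` allows the weight `γ ^ t` to be cancelled.
  rwa [integrable_smul_measure (by simp [pow_pos hγ]) ENNReal.ofReal_ne_top] at h

lemma integrable_occupation_perturb {t : ℕ}
    (hT : Integrable r (occupation P γ (φ.tail t) ∘ₘ (stateLaw P μ₀ φ t ⊗ₘ policy φ t)))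
    (k : Fin K) (c : Fin C) {h : S → ℝ} (hh : Measurable h) {B : ℝ} (hB : ∀ s, |h s| ≤ B)
    (x : ℝ) :
    Integrable r (occupation P γ (φ.tail t) ∘ₘ
      (stateLaw P μ₀ φ t ⊗ₘ policy (φ.perturb t k c h hh x) t)) :=
  (hT.smul_measure ENNReal.ofReal_ne_top).mono_measure (Measure.comp_le_smul _
    (Measure.compProd_le_smul _ fun s => policy_perturb_le φ t k c h hh hB x s))

lemma integrable_occupation_comp_perturb (hr : Measurable r) (hγ : 0 < γ)
    (hJ : ReturnIntegrable γ r (trajLaw P μ₀ φ)) (t : ℕ)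
    (k : Fin K) (c : Fin C) {h : S → ℝ} (hh : Measurable h) {B : ℝ} (hB : ∀ s, |h s| ≤ B)
    (x : ℝ) :
    Integrable r (occupation P γ (φ.perturb t k c h hh x) ∘ₘ
      (μ₀ ⊗ₘ policy (φ.perturb t k c h hh x) 0)) := by
  obtain ⟨h1, h2⟩ := integrable_occupation_tail P μ₀ hr hγ hJ t
  rw [occupation_comp_eq_of_policy_eq P μ₀ hγ.le fun m hm => policy_perturb_of_ne φ hm k c h hh x,
    integrable_add_measure]
  exact ⟨h1, (integrable_occupation_perturb P μ₀ h2 k c hh hB x).smul_measure ENNReal.ofReal_ne_top⟩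

/-- The expected return splits into a part that does not depend on the policy at time `t` and the
expected action value at time `t`. -/
lemma J_perturb (hr : Measurable r) (hγ : 0 < γ)
    (hJ : ReturnIntegrable γ r (trajLaw P μ₀ φ)) (t : ℕ)
    (k : Fin K) (c : Fin C) {h : S → ℝ} (hh : Measurable h) {B : ℝ} (hB : ∀ s, |h s| ≤ B)
    (x : ℝ) :
    J P μ₀ γ r (φ.perturb t k c h hh x) =
      ∫ p, r p ∂(∑ n ∈ Finset.range t,
        ENNReal.ofReal (γ ^ n) • (iter P φ n ∘ₘ (μ₀ ⊗ₘ policy φ 0))) +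
      γ ^ t * ∫ s, ∑ a, actionProb (shiftLogit (φ.val t s) k c (x * h s)) a *
        ∫ p, r p ∂(occupation P γ (φ.tail t) (s, a)) ∂(stateLaw P μ₀ φ t) := by
  obtain ⟨h1, h2⟩ := integrable_occupation_tail P μ₀ hr hγ hJ t
  have h3 := integrable_occupation_perturb P μ₀ h2 k c hh hB x
  rw [J, trajLaw, integral_return_rollout P hγ.le hr _ _
      (integrable_occupation_comp_perturb P μ₀ hr hγ hJ t k c hh hB x),
    occupation_comp_eq_of_policy_eq P μ₀ hγ.le fun m hm => policy_perturb_of_ne φ hm k c h hh x,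
    integral_add_measure h1 (h3.smul_measure ENNReal.ofReal_ne_top), integral_smul_measure,
    ENNReal.toReal_ofReal (pow_pos hγ t).le, smul_eq_mul, Measure.integral_comp_kernel h3,
    Measure.integral_compProd (Measure.integrable_integral_of_integrable_comp h3)]
  simp_rw [policy_apply, integral_actionPMF, perturb_val_same]

lemma ae_integrable_occupation {t : ℕ}
    (hT : Integrable r (occupation P γ (φ.tail t) ∘ₘ (stateLaw P μ₀ φ t ⊗ₘ policy φ t))) :
    ∀ᵐ s ∂(stateLaw P μ₀ φ t), ∀ a, Integrable r (occupation P γ (φ.tail t) (s, a)) := by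
  filter_upwards [Measure.ae_ae_of_ae_compProd (Measure.ae_integrable_of_integrable_comp hT)]
    with s hs a
  exact forall_of_ae_policy hs a

omit [IsProbabilityMeasure μ₀] in
lemma returnIntegrable_trajLawFrom_iff (hr : Measurable r) (hγ : 0 < γ) (t : ℕ) (s : S)
    (a : Action K C) :
    ReturnIntegrable γ r (trajLawFrom P φ t s a) ↔
      Integrable r (occupation P γ (φ.tail t) (s, a)) := by
  rw [trajLawFrom, returnIntegrable_rollout_iff P hγ.le hr, Measure.dirac_bind (Kernel.measurable _)]

lemma Q_eq_integral_occupation (hr : Measurable r) (hγ : 0 < γ) {t : ℕ} {s : S}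
    {a : Action K C} (h : Integrable r (occupation P γ (φ.tail t) (s, a))) :
    Q P γ r φ t s a = ∫ p, r p ∂(occupation P γ (φ.tail t) (s, a)) := by
  have e : occupation P γ (φ.tail t) ∘ₘ Measure.dirac (s, a) =
      occupation P γ (φ.tail t) (s, a) := Measure.dirac_bind (Kernel.measurable _) _
  rw [Q, trajLawFrom, integral_return_rollout P hγ.le hr _ _ (by rwa [e]), e]

end

end

end ARSM

theorem theorem1 {S : Type*} [MeasurableSpace S] {K C : ℕ} [NeZero C]
    (P : Kernel (S × ARSM.Action K C) S) [IsMarkovKernel P]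
    (μ₀ : Measure S) [IsProbabilityMeasure μ₀]
    (r : S × ARSM.Action K C → ℝ) (hr : Measurable r)
    (γ : ℝ) (hγ₀ : 0 < γ) (hγ₁ : γ ≤ 1)
    (φ : ARSM.LogitSeq S K C)
    -- `J` is well defined at `φ`
    (hJ : ARSM.ReturnIntegrable γ r (ARSM.trajLaw P μ₀ φ))
    (t : ℕ) (k : Fin K) (c : Fin C)
    -- the direction in which the state-dependent logit `φ_{tkc}` is varied (`h = 1`: a common shift)
    (h : S → ℝ) (hh : Measurable h) (hb : ∃ B, ∀ s, |h s| ≤ B) :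
    -- all quantities below are well defined
    (∀ x : ℝ, ARSM.ReturnIntegrable γ r (ARSM.trajLaw P μ₀ (φ.perturb t k c h hh x))) ∧
    (∀ᵐ s ∂(ARSM.stateLaw P μ₀ φ t), ∀ a,
      ARSM.ReturnIntegrable γ r (ARSM.trajLawFrom P φ t s a)) ∧
    Integrable (fun p : S × (Fin K → Fin C → ℝ) =>
        ARSM.sparseG (ARSM.Q P γ r φ t p.1) (φ.val t p.1) p.2 k c)
      ((ARSM.stateLaw P μ₀ φ t).prod (ARSM.dirichletProd K C)) ∧
    Integrable (fun p : S × (Fin K → Fin C → ℝ) =>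
        ARSM.denseG (ARSM.Q P γ r φ t p.1) (φ.val t p.1) p.2 k c)
      ((ARSM.stateLaw P μ₀ φ t).prod (ARSM.dirichletProd K C)) ∧
    -- the gradient formula with the sparse `g_{tkc}`
    HasDerivAt (fun x : ℝ => ARSM.J P μ₀ γ r (φ.perturb t k c h hh x))
      (∫ s, h s * (γ ^ t *
          ∫ ϖ, ARSM.sparseG (ARSM.Q P γ r φ t s) (φ.val t s) ϖ k c ∂(ARSM.dirichletProd K C))
        ∂(ARSM.stateLaw P μ₀ φ t)) 0 ∧
    -- the gradient formula without sparsification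
    HasDerivAt (fun x : ℝ => ARSM.J P μ₀ γ r (φ.perturb t k c h hh x))
      (∫ s, h s * (γ ^ t *
          ∫ ϖ, ARSM.denseG (ARSM.Q P γ r φ t s) (φ.val t s) ϖ k c ∂(ARSM.dirichletProd K C))
        ∂(ARSM.stateLaw P μ₀ φ t)) 0 := by
  obtain ⟨B, hB⟩ := hb
  obtain ⟨-, hT⟩ := ARSM.integrable_occupation_tail P μ₀ hr hγ₀ hJ t
  -- A jointly measurable version of `Q`: the two agree for almost every state `s_t` and every
  -- action, which suffices under all the integrals.
  set q : S × ARSM.Action K C → ℝ := fun p => ∫ w, r w ∂(ARSM.occupation P γ (φ.tail t) p)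
  have hqm : Measurable q := (hr.stronglyMeasurable.integral_kernel).measurable
  have hq : Integrable q (ARSM.stateLaw P μ₀ φ t ⊗ₘ ARSM.policy φ t) :=
    Measure.integrable_integral_of_integrable_comp hT
  have hae := ARSM.ae_integrable_occupation P μ₀ hT
  have hQ : ∀ᵐ s ∂(ARSM.stateLaw P μ₀ φ t), ARSM.Q P γ r φ t s = fun a => q (s, a) := by
    filter_upwards [hae] with s hs
    ext a
    exact ARSM.Q_eq_integral_occupation P hr hγ₀ (hs a)
  have hQprod : ∀ᵐ p ∂((ARSM.stateLaw P μ₀ φ t).prod (ARSM.dirichletProd K C)),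
      ARSM.Q P γ r φ t p.1 = fun a => q (p.1, a) := Measure.quasiMeasurePreserving_fst.ae hQ
  have hderiv : HasDerivAt (fun x : ℝ => ARSM.J P μ₀ γ r (φ.perturb t k c h hh x))
      (∫ s, h s * (γ ^ t * ARSM.policyGrad (ARSM.Q P γ r φ t s) (φ.val t s) k c)
        ∂(ARSM.stateLaw P μ₀ φ t)) 0 := by
    have hd := ((ARSM.hasDerivAt_integral_perturb hqm hq k c hh hB).const_mul (γ ^ t)).const_add
      (∫ p, r p ∂(∑ n ∈ Finset.range t,
        ENNReal.ofReal (γ ^ n) • (ARSM.iter P φ n ∘ₘ (μ₀ ⊗ₘ ARSM.policy φ 0))))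
    simp_rw [ARSM.J_perturb P μ₀ hr hγ₀ hJ t k c hh hB]
    convert! hd using 1
    rw [← integral_const_mul]
    refine integral_congr_ae ?_
    filter_upwards [hQ] with s hs
    rw [hs]
    ring
  refine ⟨fun x => ?_, ?_, ?_, ?_, ?_, ?_⟩
  · exact (ARSM.returnIntegrable_rollout_iff P hγ₀.le hr _ _).2
      (ARSM.integrable_occupation_comp_perturb P μ₀ hr hγ₀ hJ t k c hh hB x)
  · filter_upwards [hae] with s hs a
    exact (ARSM.returnIntegrable_trajLawFrom_iff P hr hγ₀ t s a).2 (hs a)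
  · refine (ARSM.integrable_sparseG_prod hq k c).congr ?_
    filter_upwards [hQprod] with p hp
    rw [hp]
  · refine (ARSM.integrable_denseG_prod hq k c).congr ?_
    filter_upwards [hQprod] with p hp
    rw [hp]
  · simpa only [ARSM.integral_sparseG] using hderiv
  · simpa only [ARSM.integral_denseG] using hderiv
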